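/- **Setting.** A host graph is a finite directed graph (parallel edges and loops allowed) whose nodes and edges carry labels (finite lists of integers and strings) and marks, and some of whose nodes are roots; its size is $|V|+|E|$. An input graph is an arbitrarily labelled host graph all of whose nodes are grey and unrooted and all of whose edges are unmarked; node degrees are not bounded. The GP 2 program `is-cycle` is $$\mathtt{Main = init;\ Reduce;\ Check},\qquad \mathtt{Reduce = \{red3, red2\}!;\ red1},\qquad \mathtt{Check = if\ match\ then\ fail},$$ with the following rules, in which all nodes are grey, all edges are unmarked, and all labels are pairwise distinct list variables. `init` turns an unrooted node into a root. `match` matches an unrooted node and changes nothing. `red1` deletes a root with a loop. `red2` deletes a 2-cycle $x\xrightarrow{a}y\xrightarrow{b}x$ ($x$ a root, $y$ unrooted) and creates a root labelled $x$ with a loop labelled $a$. `red3` replaces a path $x\xrightarrow{a}y\xrightarrow{b}z$ ($y$ a root; $x,z$ unrooted) by an edge $x\xrightarrow{a}z$, where the nodes $x,z$ are kept, $y$ is deleted and $x$ becomes the root. Matches are injective, preserve labels and marks, preserve and reflect roots, and satisfy the dangling condition (a deleted node is incident only with matched edges). Programs are executed by the small-step operational semantics of GP 2. **Running time.** One application attempt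 of a rule runs the backtracking matching algorithm along the search plan of the left-hand graph: starting at roots where there are any, otherwise at arbitrary nodes, it follows outgoing and incoming edges of nodes already found. Fetching the next node, root, outgoing or incoming edge, testing a candidate (mark, root status, degrees, already matched), and taking a candidate back each cost one unit; building the result of an application costs a constant for each rule. The rules of a rule set are tried one after the other in any order, the nodes, roots and edges of the host graph are listed in any order, each transition of the semantics costs one further unit of control time (per nesting level of sequential composition), and undoing changes costs as much as making them. Reading the input graph and writing the output graph cost the size of the graph plus one. **Theorem (Complexity of `is-cycle`).** The rules `red1`, `red2`, `red3` are fast rooted rules: every node of the left-hand graph is undirectedly reachable from a root of it, and no variable occurs twice in the left-hand or in the right-hand graph. Moreover there are constants $c,K$ such that for every input graph $G$: 1. the program `is-cycle` neither diverges nor gets stuck from $G$; 2. every (partial or complete) execution of `is-cycle` on $G$ has running time at most $c\,(|V_G|+|E_G|+1)$; 3. each completed or failed application of a rule in such an execution takes time at most $K$; 4. each execution has at most $|V_G|-1$ completed applications of `red3` and `red2` (none if $G$ is empty), and if $G$ is a cycle graph (a directed cycle with $n\ge 1$ nodes and $n$ edges), then every complete execution has exactly $|V_G|-1$ of them. -/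

import Mathlib

/-! ### Host graphs -/

/-- Marks of nodes (`none` means unmarked). -/
inductive NodeMark where
  | none | red | green | blue | grey
  deriving DecidableEq

/-- Marks of edges (`none` means unmarked). -/
inductive EdgeMark where
  | none | red | green | blue | dashed
  deriving DecidableEq

/-- Host labels are lists of integers and character strings. -/
abbrev HostLabel := List (ℤ ⊕ String)

/-- A GP 2 host graph: a finite directed graph, parallel edges and loops allowed, with labelled
and marked nodes and edges, some of whose nodes are roots. -/
structure HostGraph where
  V : Type
  E : Type
  finV : Finite V
  finE : Finite E
  src : E → V
  tgt : E → V
  nodeLabel : V → HostLabel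
  nodeMark : V → NodeMark
  rooted : V → Bool
  edgeLabel : E → HostLabel
  edgeMark : E → EdgeMark

attribute [instance] HostGraph.finV HostGraph.finE

namespace HostGraph

noncomputable def numNodes (G : HostGraph) : ℕ := Nat.card G.V

noncomputable def numEdges (G : HostGraph) : ℕ := Nat.card G.E

/-- The size of a host graph: the total number of nodes and edges. -/
noncomputable def size (G : HostGraph) : ℕ := G.numNodes + G.numEdges

noncomputable def indeg (G : HostGraph) (v : G.V) : ℕ := Nat.card {e : G.E // G.tgt e = v}

noncomputable def outdeg (G : HostGraph) (v : G.V) : ℕ := Nat.card {e : G.E // G.src e = v}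

/-- Input graphs: arbitrarily labelled host graphs in which every node is grey and unrooted and
every edge is unmarked. -/
def IsInputGraph (G : HostGraph) : Prop :=
  (∀ v, G.nodeMark v = NodeMark.grey) ∧ (∀ v, G.rooted v = false) ∧
    (∀ e, G.edgeMark e = EdgeMark.none)

/-- Cycle graphs, up to labelling: `n + 1` nodes connected by a directed cycle; for `n = 0` this
is one node with one loop (addition in `Fin (n + 1)` is modulo `n + 1`). -/
def IsCycleGraph (G : HostGraph) : Prop :=
  ∃ (n : ℕ) (v : Fin (n + 1) ≃ G.V) (e : Fin (n + 1) ≃ G.E),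
    ∀ i, G.src (e i) = v i ∧ G.tgt (e i) = v (i + 1)

end HostGraph

/-! ### Rules -/

/-- A graph of a rule with nodes `0, …, n - 1` and edges `0, …, m - 1`, labelled with list
variables from `X`. -/
structure RuleGraph (X : Type) where
  n : ℕ
  m : ℕ
  src : Fin m → Fin n
  tgt : Fin m → Fin n
  nodeLabel : Fin n → X
  nodeMark : Fin n → NodeMark
  rooted : Fin n → Bool
  edgeLabel : Fin m → X
  edgeMark : Fin m → EdgeMark

namespace RuleGraph

variable {X : Type}

def indeg (L : RuleGraph X) (v : Fin L.n) : ℕ := (Finset.univ.filter fun e => L.tgt e = v).card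

def outdeg (L : RuleGraph X) (v : Fin L.n) : ℕ := (Finset.univ.filter fun e => L.src e = v).card

/-- The label of an item (node or edge). -/
def label (L : RuleGraph X) : Fin L.n ⊕ Fin L.m → X := Sum.elim L.nodeLabel L.edgeLabel

def Adj (L : RuleGraph X) (u v : Fin L.n) : Prop :=
  ∃ e, (L.src e = u ∧ L.tgt e = v) ∨ (L.src e = v ∧ L.tgt e = u)

end RuleGraph

/-- An (unconditional) rule `L ⇒ R`. The numbered nodes are `0, …, k - 1`; number `i` is attached
to the node `numL i` of `L` and to the node `numR i` of `R`. No variable occurs twice in `L`, and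
every variable of `R` occurs in `L`. -/
structure Rule (X : Type) where
  L : RuleGraph X
  R : RuleGraph X
  k : ℕ
  numL : Fin k → Fin L.n
  numR : Fin k → Fin R.n
  numL_inj : Function.Injective numL
  numR_inj : Function.Injective numR
  linear : Function.Injective L.label
  vars : ∀ i, ∃ j, R.label i = L.label j

namespace Rule

variable {X : Type}

/-- A node of `L` is deleted by the rule when it is unnumbered. -/
def Deleted (r : Rule X) (v : Fin r.L.n) : Prop := ∀ i, r.numL i ≠ v

/-- Fast (rooted) rules: each node of `L` is undirectedly reachable from a root of `L`, and no
variable occurs twice in `L` or twice in `R`. -/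
def IsFast (r : Rule X) : Prop :=
  (∀ v, ∃ u, r.L.rooted u = true ∧ Relation.ReflTransGen r.L.Adj u v) ∧
    Function.Injective r.L.label ∧ Function.Injective r.R.label

/-- A match of a rule in `G`: an assignment of lists to the variables together with an injective
morphism from the instantiated left-hand graph to `G` that preserves labels and marks, preserves
and reflects roots, and satisfies the dangling condition. -/
structure Match (r : Rule X) (G : HostGraph) where
  assign : X → HostLabel
  node : Fin r.L.n → G.V
  edge : Fin r.L.m → G.E
  node_inj : Function.Injective node
  edge_inj : Function.Injective edge
  src_eq : ∀ e, G.src (edge e) = node (r.L.src e)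
  tgt_eq : ∀ e, G.tgt (edge e) = node (r.L.tgt e)
  nodeLabel_eq : ∀ v, G.nodeLabel (node v) = assign (r.L.nodeLabel v)
  edgeLabel_eq : ∀ e, G.edgeLabel (edge e) = assign (r.L.edgeLabel e)
  nodeMark_eq : ∀ v, G.nodeMark (node v) = r.L.nodeMark v
  edgeMark_eq : ∀ e, G.edgeMark (edge e) = r.L.edgeMark e
  rooted_eq : ∀ v, G.rooted (node v) = r.L.rooted v
  dangling : ∀ v, r.Deleted v → ∀ f : G.E, (G.src f = node v ∨ G.tgt f = node v) →
    ∃ e, edge e = f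

namespace Match

variable {r : Rule X} {G : HostGraph}

/-- The host nodes that survive the rule application. -/
def Kept (μ : Match r G) (w : G.V) : Prop := ∀ v, μ.node v = w → ¬ r.Deleted v

/-- Nodes of the result: the surviving nodes and the unnumbered nodes of `R`. -/
abbrev ResV (μ : Match r G) : Type := {w : G.V // μ.Kept w} ⊕ {u : Fin r.R.n // ∀ i, r.numR i ≠ u}

/-- Edges of the result: the unmatched edges and the edges of `R`. -/
abbrev ResE (μ : Match r G) : Type := {f : G.E // ∀ e, μ.edge e ≠ f} ⊕ Fin r.R.m

theorem kept_num (μ : Match r G) (i : Fin r.k) : μ.Kept (μ.node (r.numL i)) := by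
  intro v hv hd
  exact hd i (μ.node_inj hv.symm)

theorem kept_src (μ : Match r G) (f : {f : G.E // ∀ e, μ.edge e ≠ f}) : μ.Kept (G.src f) := by
  intro v hv hd
  obtain ⟨e, he⟩ := μ.dangling v hd f.1 (Or.inl hv.symm)
  exact f.2 e he

theorem kept_tgt (μ : Match r G) (f : {f : G.E // ∀ e, μ.edge e ≠ f}) : μ.Kept (G.tgt f) := by
  intro v hv hd
  obtain ⟨e, he⟩ := μ.dangling v hd f.1 (Or.inr hv.symm)
  exact f.2 e he

open Classical in
/-- The node of the result that a node of `R` stands for. -/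
noncomputable def comatch (μ : Match r G) (u : Fin r.R.n) : μ.ResV :=
  if h : ∃ i, r.numR i = u then Sum.inl ⟨μ.node (r.numL h.choose), μ.kept_num _⟩
  else Sum.inr ⟨u, fun i hi => h ⟨i, hi⟩⟩

open Classical in
/-- The node of `R` that determines label, mark and root status of a node of the result; a
surviving node outside the image of the match has none and keeps its own. -/
noncomputable def newNode (μ : Match r G) : μ.ResV → Option (Fin r.R.n)
  | Sum.inl w => if h : ∃ i, μ.node (r.numL i) = w then some (r.numR h.choose) else none
  | Sum.inr u => some u.1

/-- A value at a node of the result: that of the corresponding node of `R` if there is one, and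
the old value otherwise. (An unnumbered node of `R` always has a corresponding node.) -/
noncomputable def value {α : Type} (μ : Match r G) (new : Fin r.R.n → α) (old : G.V → α) :
    μ.ResV → α
  | Sum.inl w => match μ.newNode (Sum.inl w) with
    | some u => new u
    | none => old w
  | Sum.inr u => new u

/-- The result of applying the rule at a match: the matched edges and the images of unnumbered
nodes are deleted, the edges and unnumbered nodes of `R` are inserted, and the images of numbered
nodes stay in place with label, mark and root status as in `R`. -/
noncomputable def result (μ : Match r G) : HostGraph where
  V := μ.ResV
  E := μ.ResE
  finV := inferInstance
  finE := inferInstance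
  src := Sum.elim (fun f => Sum.inl ⟨G.src f, μ.kept_src f⟩) (fun e => μ.comatch (r.R.src e))
  tgt := Sum.elim (fun f => Sum.inl ⟨G.tgt f, μ.kept_tgt f⟩) (fun e => μ.comatch (r.R.tgt e))
  nodeLabel := μ.value (fun u => μ.assign (r.R.nodeLabel u)) G.nodeLabel
  nodeMark := μ.value r.R.nodeMark G.nodeMark
  rooted := μ.value r.R.rooted G.rooted
  edgeLabel := Sum.elim (fun f => G.edgeLabel f) (fun e => μ.assign (r.R.edgeLabel e))
  edgeMark := Sum.elim (fun f => G.edgeMark f) r.R.edgeMark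

end Match

end Rule

/-! ### The matching algorithm and its running time -/

/-- How the nodes, root nodes, outgoing and incoming edges of a host graph are listed in memory.
The order of each list is arbitrary. -/
structure Listing (G : HostGraph) where
  nodes : List G.V
  roots : List G.V
  outs : G.V → List G.E
  ins : G.V → List G.E
  nodes_nodup : nodes.Nodup
  roots_nodup : roots.Nodup
  outs_nodup : ∀ v, (outs v).Nodup
  ins_nodup : ∀ v, (ins v).Nodup
  mem_nodes : ∀ v, v ∈ nodes
  mem_roots : ∀ v, v ∈ roots ↔ G.rooted v = true
  mem_outs : ∀ v e, e ∈ outs v ↔ G.src e = v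
  mem_ins : ∀ v e, e ∈ ins v ↔ G.tgt e = v

/-- Operations of a search plan: find a host node for a root of `L`, find a host node for a node
of `L`, and find a host edge for an edge of `L` among the outgoing (incoming) edges of the host
node already found for its source (target). -/
inductive SearchOp {X : Type} (L : RuleGraph X) where
  | findRoot (v : Fin L.n)
  | findNode (v : Fin L.n)
  | outEdge (e : Fin L.m)
  | inEdge (e : Fin L.m)

namespace RuleGraph

variable {X : Type}

/-- The next operation of the search plan when the nodes in `N` and the edges in `M` have been
treated: proceed along an edge at a treated node if there is one, otherwise start at an untreated
root, otherwise at any untreated node. -/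
def nextOp (L : RuleGraph X) (N : List (Fin L.n)) (M : List (Fin L.m)) : Option (SearchOp L) :=
  match (List.finRange L.m).find? (fun e => decide (e ∉ M ∧ L.src e ∈ N)) with
  | some e => some (SearchOp.outEdge e)
  | none =>
    match (List.finRange L.m).find? (fun e => decide (e ∉ M ∧ L.tgt e ∈ N)) with
    | some e => some (SearchOp.inEdge e)
    | none =>
      match (List.finRange L.n).find? (fun v => decide (v ∉ N ∧ L.rooted v = true)) with
      | some v => some (SearchOp.findRoot v)
      | none =>
        match (List.finRange L.n).find? (fun v => decide (v ∉ N)) with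
        | some v => some (SearchOp.findNode v)
        | none => none

/-- At most `fuel` further operations of the search plan. -/
def planFrom (L : RuleGraph X) : ℕ → List (Fin L.n) → List (Fin L.m) → List (SearchOp L)
  | 0, _, _ => []
  | fuel + 1, N, M =>
    match L.nextOp N M with
    | none => []
    | some (SearchOp.findRoot v) => SearchOp.findRoot v :: L.planFrom fuel (v :: N) M
    | some (SearchOp.findNode v) => SearchOp.findNode v :: L.planFrom fuel (v :: N) M
    | some (SearchOp.outEdge e) => SearchOp.outEdge e :: L.planFrom fuel (L.tgt e :: N) (e :: M)
    | some (SearchOp.inEdge e) => SearchOp.inEdge e :: L.planFrom fuel (L.src e :: N) (e :: M)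

/-- The search plan of a left-hand graph; every operation treats a new node or a new edge. -/
def plan (L : RuleGraph X) : List (SearchOp L) := L.planFrom (L.n + L.m) [] []

end RuleGraph

/-- A partial match under construction. -/
structure PartialMatch {X : Type} (L : RuleGraph X) (G : HostGraph) where
  node : Fin L.n → Option G.V
  edge : Fin L.m → Option G.E

/-- Goes through a list of candidates, testing each of them and continuing with `next` after a
successful test, until the continuation succeeds. The first component of the value is the running
time: one unit for each fetch of a candidate (also for finding that none is left), one for its
test, which is a bounded number of constant-time checks, and one for taking the candidate back
when the continuation has failed. -/
def tryCandidates {α σ : Type} (test : α → Option σ) (next : σ → ℕ × Option σ) :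
    List α → ℕ × Option σ
  | [] => (1, none)
  | a :: as =>
    match test a with
    | none => ((tryCandidates test next as).1 + 2, (tryCandidates test next as).2)
    | some s =>
      match next s with
      | (t, some s') => (t + 2, some s')
      | (t, none) => ((tryCandidates test next as).1 + t + 3, (tryCandidates test next as).2)

namespace Rule

variable {X : Type}

open Classical in
/-- Test whether the host node `w` can be taken for the untreated node `v` of `L`: it is not
already matched, agrees in mark and root status, and has large enough degrees, which must be
exact if `v` is deleted. Labels need no test, since they are pairwise distinct list variables. -/
noncomputable def testNode (r : Rule X) {G : HostGraph} (v : Fin r.L.n)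
    (p : PartialMatch r.L G) (w : G.V) : Option (PartialMatch r.L G) :=
  if (∀ u, p.node u ≠ some w) ∧ G.nodeMark w = r.L.nodeMark v ∧ G.rooted w = r.L.rooted v ∧
      r.L.indeg v ≤ G.indeg w ∧ r.L.outdeg v ≤ G.outdeg w ∧
      (r.Deleted v → G.indeg w = r.L.indeg v ∧ G.outdeg w = r.L.outdeg v)
  then some { p with node := Function.update p.node v (some w) }
  else none

open Classical in
/-- Test the host node `w` at the far end of an edge: if the node `v` of `L` has been treated,
`w` must be the host node found for it. -/
noncomputable def testEnd (r : Rule X) {G : HostGraph} (v : Fin r.L.n)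
    (p : PartialMatch r.L G) (w : G.V) : Option (PartialMatch r.L G) :=
  match p.node v with
  | some w' => if w = w' then some p else none
  | none => r.testNode v p w

open Classical in
/-- Test whether the host edge `f`, with far end `w`, can be taken for the edge `e` of `L`, with
far end `v`. -/
noncomputable def testEdge (r : Rule X) {G : HostGraph} (e : Fin r.L.m) (v : Fin r.L.n)
    (p : PartialMatch r.L G) (f : G.E) (w : G.V) : Option (PartialMatch r.L G) :=
  if (∀ d, p.edge d ≠ some f) ∧ G.edgeMark f = r.L.edgeMark e
  then r.testEnd v { p with edge := Function.update p.edge e (some f) } w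
  else none

/-- The matching algorithm: a backtracking search that carries out the operations of a search
plan. It returns its running time and the partial match found, if any. -/
noncomputable def search (r : Rule X) {G : HostGraph} (ℓ : Listing G) :
    List (SearchOp r.L) → PartialMatch r.L G → ℕ × Option (PartialMatch r.L G)
  | [], p => (0, some p)
  | SearchOp.findRoot v :: ops, p => tryCandidates (r.testNode v p) (r.search ℓ ops) ℓ.roots
  | SearchOp.findNode v :: ops, p => tryCandidates (r.testNode v p) (r.search ℓ ops) ℓ.nodes
  | SearchOp.outEdge e :: ops, p =>
    match p.node (r.L.src e) with
    | none => (1, none)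
    | some w => tryCandidates (fun f => r.testEdge e (r.L.tgt e) p f (G.tgt f))
        (r.search ℓ ops) (ℓ.outs w)
  | SearchOp.inEdge e :: ops, p =>
    match p.node (r.L.tgt e) with
    | none => (1, none)
    | some w => tryCandidates (fun f => r.testEdge e (r.L.src e) p f (G.src f))
        (r.search ℓ ops) (ℓ.ins w)

/-- The run of the matching algorithm for `r` on `G` with memory order `ℓ`. -/
noncomputable def findMatch (r : Rule X) {G : HostGraph} (ℓ : Listing G) :
    ℕ × Option (PartialMatch r.L G) :=
  r.search ℓ r.L.plan ⟨fun _ => none, fun _ => none⟩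

/-- Time needed to build the result graph once a match has been found. -/
def buildTime (r : Rule X) : ℕ := r.L.n + r.L.m + r.R.n + r.R.m + 1

/-- `r.Succeeds G t H`: an attempt to apply `r` to `G` can find a match and yield `H` within time
`t` (search and construction of the result). -/
def Succeeds (r : Rule X) (G : HostGraph) (t : ℕ) (H : HostGraph) : Prop :=
  ∃ (ℓ : Listing G) (p : PartialMatch r.L G) (s : ℕ) (μ : r.Match G),
    r.findMatch ℓ = (s, some p) ∧ (∀ v, p.node v = some (μ.node v)) ∧
      (∀ e, p.edge e = some (μ.edge e)) ∧ t = s + r.buildTime ∧ H = μ.result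

/-- `r.Misses G t`: an attempt to apply `r` to `G` can find out in time `t` that there is no
match. -/
def Misses (r : Rule X) (G : HostGraph) (t : ℕ) : Prop :=
  ∃ ℓ : Listing G, r.findMatch ℓ = (t, none)

end Rule

/-! ### Programs and their operational semantics -/

/-- Command sequences over rule names from `ρ` (procedure calls are expanded). `ift C P` is
`if C then P` without an else-part. -/
inductive Com (ρ : Type) where
  | call (R : List ρ)
  | seq (P Q : Com ρ)
  | ifte (C P Q : Com ρ)
  | ift (C P : Com ρ)
  | tryte (C P Q : Com ρ)
  | alap (P : Com ρ)
  | brk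
  | skip
  | fail

/-- Configurations: a rest program with a host graph, a result graph, or failure. -/
inductive Config (ρ : Type) where
  | run (P : Com ρ) (G : HostGraph)
  | done (G : HostGraph)
  | fail

/-- What happens during an execution: `rule r ok t` is a completed (`ok = true`) or failed
(`ok = false`) application of the rule `r` that takes time `t`, search included; `control t` is
other work that takes time `t`. -/
inductive Event (ρ : Type) where
  | rule (r : ρ) (ok : Bool) (t : ℕ)
  | control (t : ℕ)

def Event.time {ρ : Type} : Event ρ → ℕ
  | Event.rule _ _ t => t
  | Event.control t => t

/-- The time taken by a sequence of events. -/
def traceTime {ρ : Type} (τ : List (Event ρ)) : ℕ := (τ.map Event.time).sum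

section Semantics

variable {X ρ : Type}

/-- The rules of a list are tried one after the other until one of them is applied, which gives
`some H`, or all of them have failed, which gives `none`. -/
inductive Tries (D : ρ → Rule X) (G : HostGraph) :
    List ρ → List (Event ρ) → Option HostGraph → Prop
  | nil : Tries D G [] [] none
  | hit {r : ρ} {rs : List ρ} {t : ℕ} {H : HostGraph} :
      (D r).Succeeds G t H → Tries D G (r :: rs) [Event.rule r true t] (some H)
  | miss {r : ρ} {rs : List ρ} {t : ℕ} {τ : List (Event ρ)} {o : Option HostGraph} :
      (D r).Misses G t → Tries D G rs τ o → Tries D G (r :: rs) (Event.rule r false t :: τ) o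

mutual

/-- The small-step transition relation, labelled with the events of the transition. The rules of
a rule set are tried in an arbitrary order. Each transition costs one unit of control time in
addition to the work of its premises. Where a transition goes back to an earlier graph, undoing
the changes is charged the time that was needed to make them. In the premises, a transition
sequence that ends in a graph or in failure has at least one transition. -/
inductive Step (D : ρ → Rule X) : Config ρ → List (Event ρ) → Config ρ → Prop
  | call₁ {R rs : List ρ} {G H : HostGraph} {τ : List (Event ρ)} :
      rs.Perm R → Tries D G rs τ (some H) →
      Step D (Config.run (Com.call R) G) (Event.control 1 :: τ) (Config.done H)
  | call₂ {R rs : List ρ} {G : HostGraph} {τ : List (Event ρ)} :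
      rs.Perm R → Tries D G rs τ none → (∀ r ∈ R, IsEmpty ((D r).Match G)) →
      Step D (Config.run (Com.call R) G) (Event.control 1 :: τ) Config.fail
  | seq₁ {P P' Q : Com ρ} {G H : HostGraph} {τ : List (Event ρ)} :
      Step D (Config.run P G) τ (Config.run P' H) →
      Step D (Config.run (Com.seq P Q) G) (Event.control 1 :: τ) (Config.run (Com.seq P' Q) H)
  | seq₂ {P Q : Com ρ} {G H : HostGraph} {τ : List (Event ρ)} :
      Step D (Config.run P G) τ (Config.done H) →
      Step D (Config.run (Com.seq P Q) G) (Event.control 1 :: τ) (Config.run Q H)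
  | seq₃ {P Q : Com ρ} {G : HostGraph} {τ : List (Event ρ)} :
      Step D (Config.run P G) τ Config.fail →
      Step D (Config.run (Com.seq P Q) G) (Event.control 1 :: τ) Config.fail
  | if₁ {C P Q : Com ρ} {G H : HostGraph} {τ : List (Event ρ)} :
      Steps D (Config.run C G) τ (Config.done H) →
      Step D (Config.run (Com.ifte C P Q) G) (Event.control (traceTime τ + 1) :: τ)
        (Config.run P G)
  | if₂ {C P Q : Com ρ} {G : HostGraph} {τ : List (Event ρ)} :
      Steps D (Config.run C G) τ Config.fail →
      Step D (Config.run (Com.ifte C P Q) G) (Event.control (traceTime τ + 1) :: τ)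
        (Config.run Q G)
  | if₃ {C P : Com ρ} {G : HostGraph} :
      Step D (Config.run (Com.ift C P) G) [Event.control 1]
        (Config.run (Com.ifte C P Com.skip) G)
  | try₁ {C P Q : Com ρ} {G H : HostGraph} {τ : List (Event ρ)} :
      Steps D (Config.run C G) τ (Config.done H) →
      Step D (Config.run (Com.tryte C P Q) G) (Event.control 1 :: τ) (Config.run P H)
  | try₂ {C P Q : Com ρ} {G : HostGraph} {τ : List (Event ρ)} :
      Steps D (Config.run C G) τ Config.fail →
      Step D (Config.run (Com.tryte C P Q) G) (Event.control (traceTime τ + 1) :: τ)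
        (Config.run Q G)
  | alap₁ {P : Com ρ} {G H : HostGraph} {τ : List (Event ρ)} :
      Steps D (Config.run P G) τ (Config.done H) →
      Step D (Config.run (Com.alap P) G) (Event.control 1 :: τ) (Config.run (Com.alap P) H)
  | alap₂ {P : Com ρ} {G : HostGraph} {τ : List (Event ρ)} :
      Steps D (Config.run P G) τ Config.fail →
      Step D (Config.run (Com.alap P) G) (Event.control (traceTime τ + 1) :: τ) (Config.done G)
  | alap₃ {P : Com ρ} {G H : HostGraph} {τ : List (Event ρ)} :
      Steps D (Config.run P G) τ (Config.run Com.brk H) →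
      Step D (Config.run (Com.alap P) G) (Event.control 1 :: τ) (Config.done H)
  | brk {P : Com ρ} {G : HostGraph} :
      Step D (Config.run (Com.seq Com.brk P) G) [Event.control 1] (Config.run Com.brk G)
  | skip {G : HostGraph} : Step D (Config.run Com.skip G) [Event.control 1] (Config.done G)
  | fail {G : HostGraph} : Step D (Config.run Com.fail G) [Event.control 1] Config.fail

/-- The reflexive-transitive closure of the transition relation, with concatenated events. -/
inductive Steps (D : ρ → Rule X) : Config ρ → List (Event ρ) → Config ρ → Prop
  | refl {γ : Config ρ} : Steps D γ [] γ
  | head {γ δ ε : Config ρ} {τ τ' : List (Event ρ)} :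
      Step D γ τ δ → Steps D δ τ' ε → Steps D γ (τ ++ τ') ε

end

/-- `P` can diverge from `G`. -/
def CanDiverge (D : ρ → Rule X) (P : Com ρ) (G : HostGraph) : Prop :=
  ∃ γ : ℕ → Config ρ, γ 0 = Config.run P G ∧ ∀ i, ∃ τ, Step D (γ i) τ (γ (i + 1))

/-- `P` can get stuck from `G`. -/
def CanGetStuck (D : ρ → Rule X) (P : Com ρ) (G : HostGraph) : Prop :=
  ∃ (Q : Com ρ) (H : HostGraph) (τ : List (Event ρ)),
    Steps D (Config.run P G) τ (Config.run Q H) ∧ ∀ τ' δ, ¬ Step D (Config.run Q H) τ' δ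

end Semantics

/-- The configuration is a result graph or failure. -/
def Config.IsFinal {ρ : Type} : Config ρ → Prop
  | Config.run _ _ => False
  | Config.done _ => True
  | Config.fail => True

/-- Time for writing the output graph, if there is one. -/
noncomputable def Config.printTime {ρ : Type} : Config ρ → ℕ
  | Config.done H => H.size + 1
  | _ => 0

/-- The running time of a (partial) execution on the input `G` with events `τ` that has arrived
at `γ`: reading the input, executing, writing the output. -/
noncomputable def runningTime {ρ : Type} (G : HostGraph) (τ : List (Event ρ)) (γ : Config ρ) : ℕ :=
  (G.size + 1) + traceTime τ + γ.printTime

/-! ### The program is-cycle -/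

namespace IsCycle

/-- The list variables of the rules. -/
inductive Var where
  | a | b | x | y | z
  deriving DecidableEq

/-- The rule names. -/
inductive Name where
  | init | red1 | red2 | red3 | matchNode
  deriving DecidableEq

/-- The graph of one grey node labelled `x`, a root or not, without edges. -/
def single (root : Bool) : RuleGraph Var where
  n := 1
  m := 0
  src := Fin.elim0
  tgt := Fin.elim0
  nodeLabel := ![Var.x]
  nodeMark := fun _ => NodeMark.grey
  rooted := ![root]
  edgeLabel := Fin.elim0
  edgeMark := Fin.elim0

/-- The graph of one grey root labelled `x` with an unmarked loop labelled `a`. -/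
def rootedLoop : RuleGraph Var where
  n := 1
  m := 1
  src := ![0]
  tgt := ![0]
  nodeLabel := ![Var.x]
  nodeMark := fun _ => NodeMark.grey
  rooted := ![true]
  edgeLabel := ![Var.a]
  edgeMark := fun _ => EdgeMark.none

/-- The empty graph. -/
def empty : RuleGraph Var where
  n := 0
  m := 0
  src := Fin.elim0
  tgt := Fin.elim0
  nodeLabel := Fin.elim0
  nodeMark := Fin.elim0
  rooted := Fin.elim0
  edgeLabel := Fin.elim0
  edgeMark := Fin.elim0

/-- A grey root labelled `x`, a grey unrooted node labelled `y`, and unmarked edges `a` from the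
root to the other node and `b` back. -/
def rootedTwoCycle : RuleGraph Var where
  n := 2
  m := 2
  src := ![0, 1]
  tgt := ![1, 0]
  nodeLabel := ![Var.x, Var.y]
  nodeMark := fun _ => NodeMark.grey
  rooted := ![true, false]
  edgeLabel := ![Var.a, Var.b]
  edgeMark := fun _ => EdgeMark.none

/-- Three grey nodes labelled `x`, `y` (the root), `z` and unmarked edges `a` from `x` to `y` and
`b` from `y` to `z`. -/
def path3 : RuleGraph Var where
  n := 3
  m := 2
  src := ![0, 1]
  tgt := ![1, 2]
  nodeLabel := ![Var.x, Var.y, Var.z]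
  nodeMark := fun _ => NodeMark.grey
  rooted := ![false, true, false]
  edgeLabel := ![Var.a, Var.b]
  edgeMark := fun _ => EdgeMark.none

/-- Two grey nodes labelled `x` (the root) and `z` and an unmarked edge `a` from `x` to `z`. -/
def path2 : RuleGraph Var where
  n := 2
  m := 1
  src := ![0]
  tgt := ![1]
  nodeLabel := ![Var.x, Var.z]
  nodeMark := fun _ => NodeMark.grey
  rooted := ![true, false]
  edgeLabel := ![Var.a]
  edgeMark := fun _ => EdgeMark.none

/-- `init`: make an unrooted grey node a root. -/
def init : Rule Var where
  L := single false
  R := single true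
  k := 1
  numL := ![(0 : Fin 1)]
  numR := ![(0 : Fin 1)]
  numL_inj := by decide
  numR_inj := by decide
  linear := by decide
  vars := by decide

/-- `red1`: delete a root with a loop; no node is numbered. -/
def red1 : Rule Var where
  L := rootedLoop
  R := empty
  k := 0
  numL := Fin.elim0
  numR := Fin.elim0
  numL_inj := by decide
  numR_inj := by decide
  linear := by decide
  vars := by decide

/-- `red2`: replace a rooted 2-cycle by a root with a loop; no node is numbered. -/
def red2 : Rule Var where
  L := rootedTwoCycle
  R := rootedLoop
  k := 0
  numL := Fin.elim0
  numR := Fin.elim0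
  numL_inj := by decide
  numR_inj := by decide
  linear := by decide
  vars := by decide

/-- `red3`: contract a path of three nodes whose middle node is the root; the two outer nodes
are numbered, and the first of them becomes the root. -/
def red3 : Rule Var where
  L := path3
  R := path2
  k := 2
  numL := ![(0 : Fin 3), (2 : Fin 3)]
  numR := ![(0 : Fin 2), (1 : Fin 2)]
  numL_inj := by decide
  numR_inj := by decide
  linear := by decide
  vars := by decide

/-- `match`: match an unrooted grey node and leave the graph unchanged. -/
def matchNode : Rule Var where
  L := single false
  R := single false
  k := 1
  numL := ![(0 : Fin 1)]
  numR := ![(0 : Fin 1)]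
  numL_inj := by decide
  numR_inj := by decide
  linear := by decide
  vars := by decide

/-- The rule declarations. -/
def decl : Name → Rule Var
  | Name.init => init
  | Name.red1 => red1
  | Name.red2 => red2
  | Name.red3 => red3
  | Name.matchNode => matchNode

/-- `Reduce = {red3, red2}!; red1` -/
def reduce : Com Name :=
  Com.seq (Com.alap (Com.call [Name.red3, Name.red2])) (Com.call [Name.red1])

/-- `Check = if match then fail` -/
def check : Com Name := Com.ift (Com.call [Name.matchNode]) Com.fail

/-- `Main = init; Reduce; Check` -/
def program : Com Name := Com.seq (Com.call [Name.init]) (Com.seq reduce check)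

/-- Completed applications of `red3` and `red2`. -/
def isReduction : Event Name → Bool
  | Event.rule Name.red3 true _ => true
  | Event.rule Name.red2 true _ => true
  | _ => false

/-- The number of completed applications of `red3` and `red2` in an execution. -/
def numReductions (τ : List (Event Name)) : ℕ := τ.countP isReduction

end IsCycle

/-! ### Lists of candidates -/

section TryCandidates

variable {α σ : Type} {test : α → Option σ} {next : σ → ℕ × Option σ} {l : List α}

-- The theorem combines a constant bound for each rule attempt, a decreasing count of remaining
-- transitions, and an invariant for cycles.
--
-- Constant-time attempts. Every graph to which a rule is applied is grey and unmarked and has at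
-- most one root (`HostGraph.IsRegular`). The search plans of `red1`, `red2` and `red3` start at a
-- root, for which there is at most one candidate, and all their other operations follow edges at
-- nodes that the rule deletes. The node test demands exact degrees there, so the candidate lists
-- stay bounded although host degrees are not (`Rule.search_time_le`). For `init` and `matchNode`
-- only a root can fail the node test, so at most one candidate is rejected
-- (`tryCandidates_time_le_five`).
--
-- Linearly many transitions. An application of `red3` or `red2` lowers the number of nodes by
-- exactly one and leaves at least one node, which bounds the reductions by `|V| - 1`.
-- `IsCycle.Reach` lists the reachable configurations together with a potential that starts at `|V|
-- + 7` and drops with each transition (`IsCycle.Reach.step`). This excludes divergence and, since a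
-- transition costs at most a constant, gives linear time. Executions do not get stuck because the
-- matching algorithm is sound and complete: an attempt either yields a match or certifies that none
-- exists (`Rule.succeeds_or_misses`).
--
-- Cycle graphs. Being a cycle survives `init` and `red3`. A cycle with a root and more than one
-- node admits `red3` or `red2` (`IsCycle.nonempty_match_of_isCyclic`), and `red2` only if exactly
-- two nodes are left. Hence the loop ends at one node, after `|V| - 1` reductions, and nothing
-- later counts as a reduction.

theorem exists_of_tryCandidates_eq_some {s' : σ}
    (h : (tryCandidates test next l).2 = some s') :
    ∃ a ∈ l, ∃ s, test a = some s ∧ (next s).2 = some s' := by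
  induction l with
  | nil => simp [tryCandidates] at h
  | cons a as ih =>
    rw [tryCandidates] at h
    cases hta : test a with
    | none =>
      rw [hta] at h
      obtain ⟨b, hb, s, hs⟩ := ih h
      exact ⟨b, List.mem_cons_of_mem _ hb, s, hs⟩
    | some s =>
      rw [hta] at h
      rcases hn : next s with ⟨t, _ | s''⟩
      · simp only [hn] at h
        obtain ⟨b, hb, s, hs⟩ := ih h
        exact ⟨b, List.mem_cons_of_mem _ hb, s, hs⟩
      · simp only [hn] at h
        exact ⟨a, List.mem_cons_self, s, hta, by rw [hn, ← h]⟩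

/-- Backtracking is complete: candidates listed before `a` either fail and are skipped or already
lead to success. The result found need not come from `a`. -/
theorem tryCandidates_isSome {a : α} {s : σ} (ha : a ∈ l) (hs : test a = some s)
    (hn : (next s).2.isSome) : (tryCandidates test next l).2.isSome := by
  induction l with
  | nil => simp at ha
  | cons b bs ih =>
    rw [tryCandidates]
    rcases List.mem_cons.1 ha with rfl | ha
    · rw [hs]
      rcases hx : next s with ⟨t, _ | s''⟩
      · simp [hx] at hn
      · simp [hx]
    · cases htb : test b with
      | none => exact ih ha
      | some s₁ =>
        rcases hx : next s₁ with ⟨t, _ | s''⟩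
        · simpa [hx] using ih ha
        · simp [hx]

/-- Fetching, testing and taking back account for the 3 per candidate, and noticing the end of the
list for the final 1. -/
theorem tryCandidates_time_le {C : ℕ}
    (h : ∀ a ∈ l, ∀ s, test a = some s → (next s).1 ≤ C) :
    (tryCandidates test next l).1 ≤ l.length * (C + 3) + 1 := by
  induction l with
  | nil => simp [tryCandidates]
  | cons a as ih =>
    have ih := ih fun b hb => h b (List.mem_cons_of_mem _ hb)
    have ha := h a List.mem_cons_self
    rw [tryCandidates, List.length_cons, Nat.add_mul]
    cases hta : test a with
    | none => simp only; omega
    | some s =>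
      have := ha s hta
      rcases hx : next s with ⟨t, _ | s''⟩ <;> rw [hx] at this <;> simp only [hx] at * <;> omega

/-- If the continuation always succeeds at no cost and at most one candidate fails its test, then
at most two candidates are tested. -/
theorem tryCandidates_time_le_five (hnext : ∀ s, next s = (0, some s)) (hl : l.Nodup)
    (h : ∀ a b, test a = none → test b = none → a = b) :
    (tryCandidates test next l).1 ≤ 5 := by
  match l with
  | [] => simp [tryCandidates]
  | [a] => cases hta : test a <;> simp [tryCandidates, hta, hnext]
  -- The worst case is one rejection followed by a success, at cost 2 + 2.
  | a :: b :: l =>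
    cases hta : test a with
    | some s => simp [tryCandidates, hta, hnext]
    | none =>
      cases htb : test b with
      | some s => simp [tryCandidates, hta, htb, hnext]
      | none =>
        have := h a b hta htb
        simp [this] at hl

end TryCandidates

/-! ### Host graphs and listings -/

open Classical in
-- Needed for progress: a rule attempt exists only relative to some memory order.
theorem Listing.nonempty (G : HostGraph) : Nonempty (Listing G) := by
  have := Fintype.ofFinite G.V
  have := Fintype.ofFinite G.E
  exact ⟨{
    nodes := Finset.univ.toList
    roots := (Finset.univ.filter fun v => G.rooted v = true).toList
    outs := fun v => (Finset.univ.filter fun e => G.src e = v).toList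
    ins := fun v => (Finset.univ.filter fun e => G.tgt e = v).toList
    nodes_nodup := Finset.nodup_toList _
    roots_nodup := Finset.nodup_toList _
    outs_nodup := fun _ => Finset.nodup_toList _
    ins_nodup := fun _ => Finset.nodup_toList _
    mem_nodes := by simp
    mem_roots := by simp
    mem_outs := by simp
    mem_ins := by simp }⟩

theorem List.Nodup.length_eq_card_subtype {α : Type} {l : List α} (hl : l.Nodup) {P : α → Prop}
    (h : ∀ a, a ∈ l ↔ P a) : l.length = Nat.card {a // P a} := by
  classical
  have e : Nat.card {a // P a} = Nat.card (l.toFinset : Set α) :=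
    Nat.card_congr (Equiv.subtypeEquivRight fun a => by simp [h])
  rw [e, Nat.card_coe_set_eq, Set.ncard_coe_finset, List.toFinset_card_of_nodup hl]

namespace Listing

variable {G : HostGraph} (ℓ : Listing G)

theorem length_outs (v : G.V) : (ℓ.outs v).length = G.outdeg v :=
  (ℓ.outs_nodup v).length_eq_card_subtype (ℓ.mem_outs v)

theorem length_ins (v : G.V) : (ℓ.ins v).length = G.indeg v :=
  (ℓ.ins_nodup v).length_eq_card_subtype (ℓ.mem_ins v)

theorem length_roots_le_one (h : ∀ v w, G.rooted v = true → G.rooted w = true → v = w) :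
    ℓ.roots.length ≤ 1 := by
  match hl : ℓ.roots with
  | [] => simp
  | [a] => simp
  | a :: b :: l =>
    have hd := ℓ.roots_nodup
    rw [hl] at hd
    have := h a b ((ℓ.mem_roots a).1 (by simp [hl])) ((ℓ.mem_roots b).1 (by simp [hl]))
    simp [this] at hd

end Listing

/-! ### Search plans -/

namespace RuleGraph

variable {X : Type} (L : RuleGraph X)

theorem indeg_eq_card (v : Fin L.n) : L.indeg v = Nat.card {e // L.tgt e = v} := by
  rw [indeg, Nat.card_eq_fintype_card, Fintype.card_subtype]

theorem outdeg_eq_card (v : Fin L.n) : L.outdeg v = Nat.card {e // L.src e = v} := by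
  rw [outdeg, Nat.card_eq_fintype_card, Fintype.card_subtype]

theorem indeg_le (v : Fin L.n) : L.indeg v ≤ L.m := by
  rw [indeg]
  simpa using Finset.card_filter_le (Finset.univ : Finset (Fin L.m)) (fun e => L.tgt e = v)

theorem outdeg_le (v : Fin L.n) : L.outdeg v ≤ L.m := by
  rw [outdeg]
  simpa using Finset.card_filter_le (Finset.univ : Finset (Fin L.m)) (fun e => L.src e = v)

/-- The condition under which a search plan may contain an operation when the nodes in `N` and
the edges in `M` have been treated. -/
def Enabled (N : List (Fin L.n)) (M : List (Fin L.m)) : SearchOp L → Prop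
  | SearchOp.findRoot v => v ∉ N ∧ L.rooted v = true
  | SearchOp.findNode v => v ∉ N
  | SearchOp.outEdge e => e ∉ M ∧ L.src e ∈ N
  | SearchOp.inEdge e => e ∉ M ∧ L.tgt e ∈ N

/-- The correctness proofs need only this property of `nextOp`; the priorities among the operations
matter for running time alone. -/
theorem enabled_of_nextOp_eq_some {N : List (Fin L.n)} {M : List (Fin L.m)} {op : SearchOp L}
    (h : L.nextOp N M = some op) : L.Enabled N M op := by
  unfold nextOp at h
  split at h
  next e he =>
    cases h
    simpa [Enabled] using List.find?_some he
  next =>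
    split at h
    next e he =>
      cases h
      simpa [Enabled] using List.find?_some he
    next =>
      split at h
      next v hv =>
        cases h
        simpa [Enabled] using List.find?_some hv
      next =>
        split at h
        next v hv =>
          cases h
          simpa [Enabled] using List.find?_some hv
        next => simp at h

end RuleGraph

namespace SearchOp

variable {X : Type} {L : RuleGraph X}

/-- The node treated by an operation. -/
def treatedNode : SearchOp L → Fin L.n
  | findRoot v => v
  | findNode v => v
  | outEdge e => L.tgt e
  | inEdge e => L.src e

/-- The edge treated by an operation, if any. -/
def treatedEdge : SearchOp L → Option (Fin L.m)
  | findRoot _ => none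
  | findNode _ => none
  | outEdge e => some e
  | inEdge e => some e

end SearchOp

namespace Rule

variable {X : Type} {r : Rule X} {G : HostGraph}

/-! ### Completeness of the matching algorithm -/

namespace Match

theorem indeg_le (μ : r.Match G) (v : Fin r.L.n) : r.L.indeg v ≤ G.indeg (μ.node v) := by
  rw [RuleGraph.indeg_eq_card, HostGraph.indeg]
  refine Nat.card_le_card_of_injective
    (fun e => ⟨μ.edge e.1, by rw [μ.tgt_eq, e.2]⟩ :
      {e // r.L.tgt e = v} → {f // G.tgt f = μ.node v}) ?_
  intro e e' h
  exact Subtype.ext (μ.edge_inj (congrArg Subtype.val h))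

theorem outdeg_le (μ : r.Match G) (v : Fin r.L.n) : r.L.outdeg v ≤ G.outdeg (μ.node v) := by
  rw [RuleGraph.outdeg_eq_card, HostGraph.outdeg]
  refine Nat.card_le_card_of_injective
    (fun e => ⟨μ.edge e.1, by rw [μ.src_eq, e.2]⟩ :
      {e // r.L.src e = v} → {f // G.src f = μ.node v}) ?_
  intro e e' h
  exact Subtype.ext (μ.edge_inj (congrArg Subtype.val h))

/-- The dangling condition makes the injection on incident edges surjective. The exact-degree test
therefore never rejects a genuine match. -/
theorem indeg_eq (μ : r.Match G) {v : Fin r.L.n} (hv : r.Deleted v) :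
    G.indeg (μ.node v) = r.L.indeg v := by
  refine le_antisymm ?_ (μ.indeg_le v)
  rw [RuleGraph.indeg_eq_card, HostGraph.indeg]
  refine Nat.card_le_card_of_surjective
    (fun e => ⟨μ.edge e.1, by rw [μ.tgt_eq, e.2]⟩ :
      {e // r.L.tgt e = v} → {f // G.tgt f = μ.node v}) ?_
  rintro ⟨f, hf⟩
  obtain ⟨e, rfl⟩ := μ.dangling v hv f (Or.inr hf)
  exact ⟨⟨e, μ.node_inj (by rw [← μ.tgt_eq, hf])⟩, rfl⟩

theorem outdeg_eq (μ : r.Match G) {v : Fin r.L.n} (hv : r.Deleted v) :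
    G.outdeg (μ.node v) = r.L.outdeg v := by
  refine le_antisymm ?_ (μ.outdeg_le v)
  rw [RuleGraph.outdeg_eq_card, HostGraph.outdeg]
  refine Nat.card_le_card_of_surjective
    (fun e => ⟨μ.edge e.1, by rw [μ.src_eq, e.2]⟩ :
      {e // r.L.src e = v} → {f // G.src f = μ.node v}) ?_
  rintro ⟨f, hf⟩
  obtain ⟨e, rfl⟩ := μ.dangling v hv f (Or.inl hf)
  exact ⟨⟨e, μ.node_inj (by rw [← μ.src_eq, hf])⟩, rfl⟩

/-- The part of a match that is defined on the nodes in `N` and the edges in `M`. -/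
def restrict (μ : r.Match G) (N : List (Fin r.L.n)) (M : List (Fin r.L.m)) :
    PartialMatch r.L G where
  node v := if v ∈ N then some (μ.node v) else none
  edge e := if e ∈ M then some (μ.edge e) else none

theorem testNode_restrict (μ : r.Match G) {N : List (Fin r.L.n)} (M : List (Fin r.L.m))
    {v : Fin r.L.n} (hv : v ∉ N) :
    r.testNode v (μ.restrict N M) (μ.node v) = some (μ.restrict (v :: N) M) := by
  rw [testNode, if_pos]
  · congr 1
    simp only [restrict, PartialMatch.mk.injEq, and_true]
    funext u
    by_cases hu : u = v
    · subst hu; simp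
    · simp [hu]
  · refine ⟨fun u hu => ?_, μ.nodeMark_eq v, μ.rooted_eq v, μ.indeg_le v, μ.outdeg_le v,
      fun h => ⟨μ.indeg_eq h, μ.outdeg_eq h⟩⟩
    simp only [restrict] at hu
    split at hu
    next huN =>
      have := μ.node_inj (Option.some.inj hu)
      exact hv (this ▸ huN)
    next => simp at hu

theorem testEdge_restrict (μ : r.Match G) (N : List (Fin r.L.n)) {M : List (Fin r.L.m)}
    {e : Fin r.L.m} (he : e ∉ M) (v : Fin r.L.n) :
    r.testEdge e v (μ.restrict N M) (μ.edge e) (μ.node v) =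
      some (μ.restrict (v :: N) (e :: M)) := by
  rw [testEdge, if_pos]
  · have hM : ({ μ.restrict N M with
        edge := Function.update (μ.restrict N M).edge e (some (μ.edge e)) } : PartialMatch r.L G) =
        μ.restrict N (e :: M) := by
      simp only [restrict, PartialMatch.mk.injEq, true_and]
      funext d
      by_cases hd : d = e
      · subst hd; simp
      · simp [hd]
    rw [hM, testEnd]
    -- If the far end was treated before, `v :: N` repeats `v`, which leaves the restriction
    -- unchanged.
    by_cases hv : v ∈ N
    · have h₁ : (μ.restrict N (e :: M)).node v = some (μ.node v) := by simp [restrict, hv]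
      have h₂ : μ.restrict (v :: N) (e :: M) = μ.restrict N (e :: M) := by
        simp only [restrict, PartialMatch.mk.injEq, and_true]
        funext u
        by_cases hu : u = v
        · subst hu; simp [hv]
        · simp [hu]
      rw [h₁, h₂]
      simp
    · have h₁ : (μ.restrict N (e :: M)).node v = none := by simp [restrict, hv]
      rw [h₁]
      exact μ.testNode_restrict _ hv
  · refine ⟨fun d hd => ?_, μ.edgeMark_eq e⟩
    simp only [restrict] at hd
    split at hd
    next hdM =>
      have := μ.edge_inj (Option.some.inj hd)
      exact he (this ▸ hdM)
    next => simp at hd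

/-- From a restriction of `μ`, the candidate prescribed by `μ` is listed and passes its test, and
the next state is again a restriction of `μ`. So one branch of the search survives to the end of the
plan, whatever the fuel. -/
theorem search_planFrom_isSome (μ : r.Match G) (ℓ : Listing G) (fuel : ℕ) :
    ∀ (N : List (Fin r.L.n)) (M : List (Fin r.L.m)),
      (r.search ℓ (r.L.planFrom fuel N M) (μ.restrict N M)).2.isSome := by
  induction fuel with
  | zero => intro N M; simp [RuleGraph.planFrom, search]
  | succ fuel ih =>
    intro N M
    rw [RuleGraph.planFrom]
    split
    next => simp [search]
    next v hop =>
      obtain ⟨hv, hr⟩ := r.L.enabled_of_nextOp_eq_some hop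
      rw [search]
      exact tryCandidates_isSome ((ℓ.mem_roots _).2 ((μ.rooted_eq v).trans hr))
        (μ.testNode_restrict M hv) (ih _ _)
    next v hop =>
      have hv := r.L.enabled_of_nextOp_eq_some hop
      rw [search]
      exact tryCandidates_isSome (ℓ.mem_nodes _) (μ.testNode_restrict M hv) (ih _ _)
    next e hop =>
      obtain ⟨he, hs⟩ := r.L.enabled_of_nextOp_eq_some hop
      have : (μ.restrict N M).node (r.L.src e) = some (μ.node (r.L.src e)) := by
        simp [restrict, hs]
      rw [search, this]
      refine tryCandidates_isSome ((ℓ.mem_outs _ _).2 (μ.src_eq e)) ?_ (ih _ _)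
      rw [μ.tgt_eq]
      exact μ.testEdge_restrict N he _
    next e hop =>
      obtain ⟨he, hs⟩ := r.L.enabled_of_nextOp_eq_some hop
      have : (μ.restrict N M).node (r.L.tgt e) = some (μ.node (r.L.tgt e)) := by
        simp [restrict, hs]
      rw [search, this]
      refine tryCandidates_isSome ((ℓ.mem_ins _ _).2 (μ.tgt_eq e)) ?_ (ih _ _)
      rw [μ.src_eq]
      exact μ.testEdge_restrict N he _

theorem findMatch_isSome (μ : r.Match G) (ℓ : Listing G) : (r.findMatch ℓ).2.isSome := by
  have := μ.search_planFrom_isSome ℓ (r.L.n + r.L.m) [] []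
  simpa [findMatch, RuleGraph.plan, restrict] using this

end Match

/-! ### Soundness of the matching algorithm -/

/-- A partial match that satisfies the requirements of a match as far as it is defined. -/
structure Sound (r : Rule X) {G : HostGraph} (p : PartialMatch r.L G) : Prop where
  node_inj : ∀ u v w, p.node u = some w → p.node v = some w → u = v
  edge_inj : ∀ d e f, p.edge d = some f → p.edge e = some f → d = e
  ends : ∀ e f, p.edge e = some f →
    p.node (r.L.src e) = some (G.src f) ∧ p.node (r.L.tgt e) = some (G.tgt f)
  edgeMark : ∀ e f, p.edge e = some f → G.edgeMark f = r.L.edgeMark e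
  nodeMark : ∀ v w, p.node v = some w → G.nodeMark w = r.L.nodeMark v
  rooted : ∀ v w, p.node v = some w → G.rooted w = r.L.rooted v
  degrees : ∀ v w, p.node v = some w → r.Deleted v →
    G.indeg w = r.L.indeg v ∧ G.outdeg w = r.L.outdeg v

theorem testNode_eq_some {v : Fin r.L.n} {p q : PartialMatch r.L G} {w : G.V}
    (h : r.testNode v p w = some q) :
    ((∀ u, p.node u ≠ some w) ∧ G.nodeMark w = r.L.nodeMark v ∧ G.rooted w = r.L.rooted v ∧
      (r.Deleted v → G.indeg w = r.L.indeg v ∧ G.outdeg w = r.L.outdeg v)) ∧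
    q = { p with node := Function.update p.node v (some w) } := by
  rw [testNode] at h
  split at h
  next hc => exact ⟨⟨hc.1, hc.2.1, hc.2.2.1, hc.2.2.2.2.2⟩, (Option.some.inj h).symm⟩
  next => simp at h

/-- That `v` is still unassigned is essential: overwriting a value could spoil the ends of edges
already matched. -/
theorem Sound.testNode {v : Fin r.L.n} {p q : PartialMatch r.L G} {w : G.V} (hp : r.Sound p)
    (hv : p.node v = none) (h : r.testNode v p w = some q) : r.Sound q := by
  obtain ⟨⟨hw, hm, hr, hd⟩, rfl⟩ := testNode_eq_some h
  have key : ∀ u x, Function.update p.node v (some w) u = some x →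
      (u = v ∧ x = w) ∨ (u ≠ v ∧ p.node u = some x) := by
    intro u x hu
    by_cases huv : u = v
    · subst huv
      rw [Function.update_self] at hu
      exact Or.inl ⟨rfl, (Option.some.inj hu).symm⟩
    · rw [Function.update_of_ne huv] at hu
      exact Or.inr ⟨huv, hu⟩
  have mono : ∀ u x, p.node u = some x → Function.update p.node v (some w) u = some x := by
    intro u x hu
    rw [Function.update_of_ne, hu]
    rintro rfl
    simp [hv] at hu
  refine ⟨?_, hp.edge_inj, fun e f hf => ⟨mono _ _ (hp.ends e f hf).1, mono _ _ (hp.ends e f hf).2⟩,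
    hp.edgeMark, ?_, ?_, ?_⟩
  · intro u u' x hu hu'
    rcases key u x hu with ⟨h₁, h₂⟩ | ⟨h₁, h₂⟩ <;> rcases key u' x hu' with ⟨h₃, h₄⟩ | ⟨h₃, h₄⟩
    · rw [h₁, h₃]
    · exact absurd (h₂ ▸ h₄) (hw _)
    · exact absurd (h₄ ▸ h₂) (hw _)
    · exact hp.node_inj _ _ _ h₂ h₄
  · intro u x hu
    rcases key u x hu with ⟨rfl, rfl⟩ | ⟨-, h₂⟩
    exacts [hm, hp.nodeMark _ _ h₂]
  · intro u x hu
    rcases key u x hu with ⟨rfl, rfl⟩ | ⟨-, h₂⟩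
    exacts [hr, hp.rooted _ _ h₂]
  · intro u x hu
    rcases key u x hu with ⟨rfl, rfl⟩ | ⟨-, h₂⟩
    exacts [hd, hp.degrees _ _ h₂]

/-- The nodes and edges on which a partial match is defined. -/
def Domain (p : PartialMatch r.L G) (N : List (Fin r.L.n)) (M : List (Fin r.L.m)) : Prop :=
  (∀ v, v ∈ N ↔ p.node v ≠ none) ∧ ∀ e, e ∈ M ↔ p.edge e ≠ none

theorem Domain.testNode {v : Fin r.L.n} {p q : PartialMatch r.L G} {w : G.V}
    {N : List (Fin r.L.n)} {M : List (Fin r.L.m)} (hp : Domain p N M)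
    (h : r.testNode v p w = some q) : Domain q (v :: N) M := by
  obtain ⟨-, rfl⟩ := testNode_eq_some h
  refine ⟨fun u => ?_, hp.2⟩
  by_cases hu : u = v
  · subst hu; simp
  · simp [hu, hp.1]

/-- The test of an edge can be split into the test of the far end and the extension by the
edge. -/
theorem testEdge_eq_some {e : Fin r.L.m} {v : Fin r.L.n} {p q : PartialMatch r.L G} {f : G.E}
    {w : G.V} (h : r.testEdge e v p f w = some q) :
    ∃ p', ((p' = p ∧ p.node v = some w) ∨ (p.node v = none ∧ r.testNode v p w = some p')) ∧
      (∀ d, p.edge d ≠ some f) ∧ G.edgeMark f = r.L.edgeMark e ∧ p'.edge = p.edge ∧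
      q = { p' with edge := Function.update p'.edge e (some f) } := by
  rw [testEdge] at h
  split at h
  next hc =>
    rw [testEnd] at h
    split at h
    next w' hw' =>
      split at h
      next hww =>
        subst hww
        exact ⟨p, Or.inl ⟨rfl, hw'⟩, hc.1, hc.2, rfl, (Option.some.inj h).symm⟩
      next => simp at h
    next hv =>
      rw [Rule.testNode] at h
      split at h
      next hw =>
        refine ⟨{ p with node := Function.update p.node v (some w) }, Or.inr ⟨hv, ?_⟩, hc.1, hc.2,
          rfl, (Option.some.inj h).symm⟩
        rw [Rule.testNode, if_pos hw]
      next => simp at h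
  next => simp at h

theorem Sound.extendEdge {p : PartialMatch r.L G} (hp : r.Sound p) {e : Fin r.L.m} {f : G.E}
    (hf : ∀ d, p.edge d ≠ some f) (hm : G.edgeMark f = r.L.edgeMark e)
    (hs : p.node (r.L.src e) = some (G.src f)) (ht : p.node (r.L.tgt e) = some (G.tgt f)) :
    r.Sound { p with edge := Function.update p.edge e (some f) } := by
  have key : ∀ d g, Function.update p.edge e (some f) d = some g →
      (d = e ∧ g = f) ∨ p.edge d = some g := by
    intro d g hd
    by_cases hde : d = e
    · subst hde
      rw [Function.update_self] at hd
      exact Or.inl ⟨rfl, (Option.some.inj hd).symm⟩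
    · rw [Function.update_of_ne hde] at hd
      exact Or.inr hd
  refine ⟨hp.node_inj, ?_, ?_, ?_, hp.nodeMark, hp.rooted, hp.degrees⟩
  · intro d d' g hd hd'
    rcases key d g hd with ⟨h₁, h₂⟩ | h₂ <;> rcases key d' g hd' with ⟨h₃, h₄⟩ | h₄
    · rw [h₁, h₃]
    · exact absurd (h₂ ▸ h₄) (hf _)
    · exact absurd (h₄ ▸ h₂) (hf _)
    · exact hp.edge_inj _ _ _ h₂ h₄
  · intro d g hd
    rcases key d g hd with ⟨rfl, rfl⟩ | h₂
    exacts [⟨hs, ht⟩, hp.ends _ _ h₂]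
  · intro d g hd
    rcases key d g hd with ⟨rfl, rfl⟩ | h₂
    exacts [hm, hp.edgeMark _ _ h₂]

theorem Domain.extendEdge {p : PartialMatch r.L G} {N : List (Fin r.L.n)} {M : List (Fin r.L.m)}
    (hp : Domain p N M) (e : Fin r.L.m) (f : G.E) :
    Domain { p with edge := Function.update p.edge e (some f) } N (e :: M) := by
  refine ⟨hp.1, fun d => ?_⟩
  by_cases hd : d = e
  · subst hd; simp
  · simp [hd, hp.2]

/-- After a successful test of an edge one of whose ends has been treated, the partial match is
sound and defined on the edge and on its far end. -/
theorem Sound.testEdge {e : Fin r.L.m} {v : Fin r.L.n} {p q : PartialMatch r.L G} {f : G.E}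
    {w : G.V} {N : List (Fin r.L.n)} {M : List (Fin r.L.m)} (hp : r.Sound p) (hD : Domain p N M)
    (h : r.testEdge e v p f w = some q)
    (hends : (v = r.L.tgt e ∧ w = G.tgt f ∧ p.node (r.L.src e) = some (G.src f)) ∨
      (v = r.L.src e ∧ w = G.src f ∧ p.node (r.L.tgt e) = some (G.tgt f))) :
    r.Sound q ∧ Domain q (v :: N) (e :: M) := by
  obtain ⟨p', hp', hf, hm, hpe, rfl⟩ := testEdge_eq_some h
  have hmono : ∀ u x, p.node u = some x → p'.node u = some x := by
    intro u x hu
    rcases hp' with ⟨rfl, -⟩ | ⟨hv, ht⟩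
    · exact hu
    · obtain ⟨-, rfl⟩ := testNode_eq_some ht
      simp only
      rw [Function.update_of_ne, hu]
      rintro rfl
      simp [hv] at hu
  have hvw : p'.node v = some w := by
    rcases hp' with ⟨rfl, h⟩ | ⟨-, ht⟩
    · exact h
    · obtain ⟨-, rfl⟩ := testNode_eq_some ht
      simp
  have hs : r.Sound p' := by
    rcases hp' with ⟨rfl, -⟩ | ⟨hv, ht⟩
    exacts [hp, hp.testNode hv ht]
  have hd : Domain p' (v :: N) M := by
    rcases hp' with ⟨rfl, hv⟩ | ⟨hv, ht⟩
    · refine ⟨fun u => ?_, hD.2⟩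
      rw [List.mem_cons, hD.1]
      constructor
      · rintro (rfl | h)
        · simp [hv]
        · exact h
      · exact Or.inr
    · exact hD.testNode ht
  refine ⟨hs.extendEdge (by rwa [hpe]) hm ?_ ?_, hd.extendEdge e f⟩
  · rcases hends with ⟨-, -, h⟩ | ⟨rfl, rfl, -⟩
    exacts [hmono _ _ h, hvw]
  · rcases hends with ⟨rfl, rfl, -⟩ | ⟨-, -, h⟩
    exacts [hvw, hmono _ _ h]

/-- Tracking the domain serves two purposes: an operation marked enabled by the lists really meets
an unassigned node, and at the end everything treated by the plan is known to be assigned. -/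
theorem sound_of_search_planFrom (ℓ : Listing G) (fuel : ℕ) :
    ∀ (N : List (Fin r.L.n)) (M : List (Fin r.L.m)) (p q : PartialMatch r.L G),
      r.Sound p → Domain p N M → (r.search ℓ (r.L.planFrom fuel N M) p).2 = some q →
      r.Sound q ∧
      (∀ v, (v ∈ N ∨ ∃ op ∈ r.L.planFrom fuel N M, op.treatedNode = v) → q.node v ≠ none) ∧
      (∀ e, (e ∈ M ∨ ∃ op ∈ r.L.planFrom fuel N M, op.treatedEdge = some e) →
        q.edge e ≠ none) := by
  induction fuel with
  | zero =>
    intro N M p q hp hD h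
    simp only [RuleGraph.planFrom, search, Option.some.injEq] at h
    subst h
    simp [RuleGraph.planFrom, hp, hD.1, hD.2]
  | succ fuel ih =>
    intro N M p q hp hD h
    rw [RuleGraph.planFrom] at h ⊢
    split at h
    next hop =>
      simp only [search, Option.some.injEq] at h
      subst h
      simp [hp, hD.1, hD.2]
    next v hop =>
      obtain ⟨hv, hr⟩ := r.L.enabled_of_nextOp_eq_some hop
      rw [search] at h
      obtain ⟨w, -, s, hs, hq⟩ := exists_of_tryCandidates_eq_some h
      have hv' : p.node v = none := by simpa [hv] using (hD.1 v).not
      obtain ⟨h₁, h₂, h₃⟩ := ih _ _ _ _ (hp.testNode hv' hs) (hD.testNode hs) hq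
      refine ⟨h₁, fun u hu => h₂ u ?_, fun e he => h₃ e ?_⟩
      · simp only [List.mem_cons, exists_eq_or_imp, SearchOp.treatedNode] at hu ⊢
        tauto
      · simpa [SearchOp.treatedEdge] using he
    next v hop =>
      have hv := r.L.enabled_of_nextOp_eq_some hop
      rw [search] at h
      obtain ⟨w, -, s, hs, hq⟩ := exists_of_tryCandidates_eq_some h
      have hv' : p.node v = none := by simpa [show v ∉ N from hv] using (hD.1 v).not
      obtain ⟨h₁, h₂, h₃⟩ := ih _ _ _ _ (hp.testNode hv' hs) (hD.testNode hs) hq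
      refine ⟨h₁, fun u hu => h₂ u ?_, fun e he => h₃ e ?_⟩
      · simp only [List.mem_cons, exists_eq_or_imp, SearchOp.treatedNode] at hu ⊢
        tauto
      · simpa [SearchOp.treatedEdge] using he
    next e hop =>
      rw [search] at h
      split at h
      next => simp at h
      next w hw =>
        obtain ⟨f, hf, s, hs, hq⟩ := exists_of_tryCandidates_eq_some h
        obtain ⟨hs₁, hs₂⟩ := hp.testEdge hD hs
          (Or.inl ⟨rfl, rfl, by rw [hw, (ℓ.mem_outs _ _).1 hf]⟩)
        obtain ⟨h₁, h₂, h₃⟩ := ih _ _ _ _ hs₁ hs₂ hq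
        refine ⟨h₁, fun u hu => h₂ u ?_, fun d hd => h₃ d ?_⟩
        · simp only [List.mem_cons, exists_eq_or_imp, SearchOp.treatedNode] at hu ⊢
          tauto
        · simp only [List.mem_cons, exists_eq_or_imp, SearchOp.treatedEdge,
            Option.some.injEq] at hd ⊢
          tauto
    next e hop =>
      rw [search] at h
      split at h
      next => simp at h
      next w hw =>
        obtain ⟨f, hf, s, hs, hq⟩ := exists_of_tryCandidates_eq_some h
        obtain ⟨hs₁, hs₂⟩ := hp.testEdge hD hs
          (Or.inr ⟨rfl, rfl, by rw [hw, (ℓ.mem_ins _ _).1 hf]⟩)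
        obtain ⟨h₁, h₂, h₃⟩ := ih _ _ _ _ hs₁ hs₂ hq
        refine ⟨h₁, fun u hu => h₂ u ?_, fun d hd => h₃ d ?_⟩
        · simp only [List.mem_cons, exists_eq_or_imp, SearchOp.treatedNode] at hu ⊢
          tauto
        · simp only [List.mem_cons, exists_eq_or_imp, SearchOp.treatedEdge,
            Option.some.injEq] at hd ⊢
          tauto

/-- A sound partial match that is defined everywhere is a match. -/
theorem Sound.exists_match {p : PartialMatch r.L G} (hp : r.Sound p)
    (hN : ∀ v, p.node v ≠ none) (hM : ∀ e, p.edge e ≠ none) :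
    ∃ μ : r.Match G, (∀ v, p.node v = some (μ.node v)) ∧ ∀ e, p.edge e = some (μ.edge e) := by
  choose nd hnd using fun v => Option.ne_none_iff_exists'.1 (hN v)
  choose ed hed using fun e => Option.ne_none_iff_exists'.1 (hM e)
  have hsrc : ∀ e, G.src (ed e) = nd (r.L.src e) := fun e =>
    Option.some.inj ((hp.ends e _ (hed e)).1.symm.trans (hnd _))
  have htgt : ∀ e, G.tgt (ed e) = nd (r.L.tgt e) := fun e =>
    Option.some.inj ((hp.ends e _ (hed e)).2.symm.trans (hnd _))
  have hedinj : Function.Injective ed := fun d e h =>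
    hp.edge_inj d e (ed e) (h ▸ hed d) (hed e)
  -- No variable occurs twice in `L`, so the host labels can be read back as an assignment.
  -- Variables outside `L` receive the empty list.
  let itemLabel : Fin r.L.n ⊕ Fin r.L.m → HostLabel :=
    Sum.elim (fun v => G.nodeLabel (nd v)) (fun e => G.edgeLabel (ed e))
  have hlab := r.linear.extend_apply itemLabel (fun _ => [])
  refine ⟨⟨Function.extend r.L.label itemLabel fun _ => [], nd, ed,
    fun u v h => hp.node_inj u v (nd v) (h ▸ hnd u) (hnd v), hedinj, hsrc, htgt,
    fun v => (hlab (Sum.inl v)).symm, fun e => (hlab (Sum.inr e)).symm,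
    fun v => hp.nodeMark _ _ (hnd v), fun e => hp.edgeMark _ _ (hed e),
    fun v => hp.rooted _ _ (hnd v), ?_⟩, hnd, hed⟩
  -- Equal finite degrees turn the injection on incident edges into a bijection, which yields the
  -- dangling condition.
  intro v hv f hf
  obtain ⟨hin, hout⟩ := hp.degrees v _ (hnd v) hv
  rcases hf with hf | hf
  · rw [RuleGraph.outdeg_eq_card, HostGraph.outdeg] at hout
    let φ : {e // r.L.src e = v} → {f // G.src f = nd v} :=
      fun e => ⟨ed e.1, by rw [hsrc, e.2]⟩
    have hφ : Function.Bijective φ := (Nat.bijective_iff_injective_and_card φ).2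
      ⟨fun e e' h => Subtype.ext (hedinj (congrArg Subtype.val h)), hout.symm⟩
    obtain ⟨e, he⟩ := hφ.2 ⟨f, hf⟩
    exact ⟨e.1, congrArg Subtype.val he⟩
  · rw [RuleGraph.indeg_eq_card, HostGraph.indeg] at hin
    let φ : {e // r.L.tgt e = v} → {f // G.tgt f = nd v} :=
      fun e => ⟨ed e.1, by rw [htgt, e.2]⟩
    have hφ : Function.Bijective φ := (Nat.bijective_iff_injective_and_card φ).2
      ⟨fun e e' h => Subtype.ext (hedinj (congrArg Subtype.val h)), hin.symm⟩
    obtain ⟨e, he⟩ := hφ.2 ⟨f, hf⟩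
    exact ⟨e.1, congrArg Subtype.val he⟩

/-- The search plan treats all nodes and edges of the left-hand graph. -/
def PlanCovers (r : Rule X) : Prop :=
  (∀ v, ∃ op ∈ r.L.plan, op.treatedNode = v) ∧ ∀ e, ∃ op ∈ r.L.plan, op.treatedEdge = some e

theorem exists_match_of_findMatch (hr : r.PlanCovers) (ℓ : Listing G) {p : PartialMatch r.L G}
    (h : (r.findMatch ℓ).2 = some p) :
    ∃ μ : r.Match G, (∀ v, p.node v = some (μ.node v)) ∧ ∀ e, p.edge e = some (μ.edge e) := by
  obtain ⟨hs, hN, hM⟩ := sound_of_search_planFrom ℓ (r.L.n + r.L.m) [] [] _ p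
    (by constructor <;> simp) (by simp [Domain]) h
  exact hs.exists_match (fun v => hN v (Or.inr (hr.1 v))) (fun e => hM e (Or.inr (hr.2 e)))

/-- Soundness turns a search result into a match; completeness turns a failed search into the
absence of matches, which the failure transition `Step.call₂` demands separately. -/
theorem succeeds_or_misses (hr : r.PlanCovers) (G : HostGraph) :
    (∃ t H, r.Succeeds G t H) ∨ ((∃ t, r.Misses G t) ∧ IsEmpty (r.Match G)) := by
  obtain ⟨ℓ⟩ := Listing.nonempty G
  rcases hx : r.findMatch ℓ with ⟨s, _ | p⟩
  · refine Or.inr ⟨⟨s, ℓ, hx⟩, ⟨fun μ => ?_⟩⟩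
    simpa [hx] using μ.findMatch_isSome ℓ
  · obtain ⟨μ, hμ⟩ := exists_match_of_findMatch hr ℓ (p := p) (by rw [hx])
    exact Or.inl ⟨_, _, ℓ, p, s, μ, hx, hμ.1, hμ.2, rfl, rfl⟩

/-! ### The running time of the matching algorithm -/

/-- Operations that have a bounded number of candidates: roots, and edges at a node that is to be
deleted. -/
def Local (r : Rule X) : SearchOp r.L → Prop
  | SearchOp.findRoot _ => True
  | SearchOp.findNode _ => False
  | SearchOp.outEdge e => r.Deleted (r.L.src e)
  | SearchOp.inEdge e => r.Deleted (r.L.tgt e)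

/-- A bound for the running time of a number of local operations. -/
def localBound (r : Rule X) : ℕ → ℕ
  | 0 => 0
  | k + 1 => (r.L.m + 1) * (r.localBound k + 3) + 1

/-- The host nodes found for nodes that are to be deleted have the right degrees. -/
def ExactDegrees (p : PartialMatch r.L G) : Prop :=
  ∀ v w, p.node v = some w → r.Deleted v → G.indeg w = r.L.indeg v ∧ G.outdeg w = r.L.outdeg v

theorem ExactDegrees.testNode {v : Fin r.L.n} {p q : PartialMatch r.L G} {w : G.V}
    (hp : ExactDegrees p) (h : r.testNode v p w = some q) : ExactDegrees q := by
  obtain ⟨⟨-, -, -, hd⟩, rfl⟩ := testNode_eq_some h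
  intro u x hu
  by_cases huv : u = v
  · subst huv
    simp only [Function.update_self, Option.some.injEq] at hu
    exact hu ▸ hd
  · simp only [Function.update_of_ne huv] at hu
    exact hp u x hu

theorem ExactDegrees.testEdge {e : Fin r.L.m} {v : Fin r.L.n} {p q : PartialMatch r.L G} {f : G.E}
    {w : G.V} (hp : ExactDegrees p) (h : r.testEdge e v p f w = some q) : ExactDegrees q := by
  obtain ⟨p', hp', -, -, -, rfl⟩ := testEdge_eq_some h
  have h' : ExactDegrees p' := by
    rcases hp' with ⟨rfl, -⟩ | ⟨-, ht⟩
    exacts [hp, hp.testNode ht]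
  exact h'

/-- A local operation branches at most `m + 1` times: there is at most one root, and the host node
at which an edge is sought has the degrees of a node of `L`. The bound is thus independent of the
host graph. -/
theorem search_time_le (ℓ : Listing G) (hroots : ℓ.roots.length ≤ 1) (ops : List (SearchOp r.L)) :
    ∀ p : PartialMatch r.L G, ExactDegrees p → (∀ op ∈ ops, r.Local op) →
      (r.search ℓ ops p).1 ≤ r.localBound ops.length := by
  induction ops with
  | nil => intro p _ _; simp [search, localBound]
  | cons op ops ih =>
    intro p hp hops
    have hop := hops op List.mem_cons_self
    have ih := fun q hq => ih q hq fun op h => hops op (List.mem_cons_of_mem _ h)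
    -- The factor `m + 1` covers both the single root candidate and the at most `m` edge candidates.
    have hbound : ∀ k, k ≤ r.L.m + 1 →
        k * (r.localBound ops.length + 3) + 1 ≤ r.localBound (ops.length + 1) := fun k hk =>
      Nat.add_le_add_right (Nat.mul_le_mul_right _ hk) 1
    rw [List.length_cons]
    match op, hop with
    | SearchOp.findRoot v, _ =>
      rw [search]
      exact (tryCandidates_time_le fun w _ q hq => ih q (hp.testNode hq)).trans
        (hbound _ (by omega))
    | SearchOp.outEdge e, hop =>
      rw [search]
      split
      next => exact Nat.le_add_left _ _
      next w hw =>
        refine (tryCandidates_time_le fun f _ q hq => ih q (hp.testEdge hq)).trans (hbound _ ?_)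
        have := r.L.outdeg_le (r.L.src e)
        rw [ℓ.length_outs, (hp _ _ hw hop).2]
        omega
    | SearchOp.inEdge e, hop =>
      rw [search]
      split
      next => exact Nat.le_add_left _ _
      next w hw =>
        refine (tryCandidates_time_le fun f _ q hq => ih q (hp.testEdge hq)).trans (hbound _ ?_)
        have := r.L.indeg_le (r.L.tgt e)
        rw [ℓ.length_ins, (hp _ _ hw hop).1]
        omega

theorem findMatch_time_le (hr : ∀ op ∈ r.L.plan, r.Local op)
    (hG : ∀ v w, G.rooted v = true → G.rooted w = true → v = w) (ℓ : Listing G) :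
    (r.findMatch ℓ).1 ≤ r.localBound r.L.plan.length :=
  search_time_le ℓ (ℓ.length_roots_le_one hG) _ _ (by simp [ExactDegrees]) hr

/-! ### The result of a rule application -/

namespace Match

variable (μ : r.Match G)

/-- `G` splits into kept and deleted nodes, `L` into deleted and numbered ones, `R` into new and
numbered ones; the numbered nodes cancel. The additive form avoids truncated subtraction. -/
theorem numNodes_result : μ.result.numNodes + r.L.n = G.numNodes + r.R.n := by
  classical
  have hR : Nat.card {u : Fin r.R.n // ∀ i, r.numR i ≠ u} + r.k = r.R.n := by
    have e : {u : Fin r.R.n // ∀ i, r.numR i ≠ u} ⊕ Fin r.k ≃ Fin r.R.n := by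
      refine Equiv.ofBijective (Sum.elim Subtype.val r.numR) ⟨?_, ?_⟩
      · rintro (⟨u, hu⟩ | i) (⟨u', hu'⟩ | j) h
        · exact congrArg _ (Subtype.ext h)
        · exact absurd h.symm (hu j)
        · exact absurd h (hu' i)
        · exact congrArg _ (r.numR_inj h)
      · intro u
        by_cases h : ∃ i, r.numR i = u
        · obtain ⟨i, rfl⟩ := h
          exact ⟨Sum.inr i, rfl⟩
        · exact ⟨Sum.inl ⟨u, not_exists.1 h⟩, rfl⟩
    simpa [Nat.card_sum] using Nat.card_congr e
  have hL : Nat.card {v : Fin r.L.n // r.Deleted v} + r.k = r.L.n := by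
    have e : {v : Fin r.L.n // r.Deleted v} ⊕ Fin r.k ≃ Fin r.L.n := by
      refine Equiv.ofBijective (Sum.elim Subtype.val r.numL) ⟨?_, ?_⟩
      · rintro (⟨u, hu⟩ | i) (⟨u', hu'⟩ | j) h
        · exact congrArg _ (Subtype.ext h)
        · exact absurd h.symm (hu j)
        · exact absurd h (hu' i)
        · exact congrArg _ (r.numL_inj h)
      · intro u
        by_cases h : ∃ i, r.numL i = u
        · obtain ⟨i, rfl⟩ := h
          exact ⟨Sum.inr i, rfl⟩
        · exact ⟨Sum.inl ⟨u, not_exists.1 h⟩, rfl⟩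
    simpa [Nat.card_sum] using Nat.card_congr e
  have hG : Nat.card {w : G.V // μ.Kept w} + Nat.card {v : Fin r.L.n // r.Deleted v} =
      G.numNodes := by
    have e : {w : G.V // μ.Kept w} ⊕ {v : Fin r.L.n // r.Deleted v} ≃ G.V := by
      refine Equiv.ofBijective (Sum.elim Subtype.val fun v => μ.node v) ⟨?_, ?_⟩
      · rintro (⟨u, hu⟩ | ⟨i, hi⟩) (⟨u', hu'⟩ | ⟨j, hj⟩) h
        · exact congrArg _ (Subtype.ext h)
        · exact absurd hj (hu j h.symm)
        · exact absurd hi (hu' i h)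
        · exact congrArg _ (Subtype.ext (μ.node_inj h))
      · intro w
        by_cases h : μ.Kept w
        · exact ⟨Sum.inl ⟨w, h⟩, rfl⟩
        · simp only [Kept, not_forall, not_not] at h
          obtain ⟨v, rfl, hv⟩ := h
          exact ⟨Sum.inr ⟨v, hv⟩, rfl⟩
    rw [HostGraph.numNodes, ← Nat.card_congr e, Nat.card_sum]
  have : μ.result.numNodes =
      Nat.card {w : G.V // μ.Kept w} + Nat.card {u : Fin r.R.n // ∀ i, r.numR i ≠ u} := by
    rw [HostGraph.numNodes, result, ← Nat.card_sum]
  omega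

theorem numEdges_result : μ.result.numEdges + r.L.m = G.numEdges + r.R.m := by
  classical
  have hG : Nat.card {f : G.E // ∀ e, μ.edge e ≠ f} + r.L.m = G.numEdges := by
    have e : {f : G.E // ∀ e, μ.edge e ≠ f} ⊕ Fin r.L.m ≃ G.E := by
      refine Equiv.ofBijective (Sum.elim Subtype.val μ.edge) ⟨?_, ?_⟩
      · rintro (⟨u, hu⟩ | i) (⟨u', hu'⟩ | j) h
        · exact congrArg _ (Subtype.ext h)
        · exact absurd h.symm (hu j)
        · exact absurd h (hu' i)
        · exact congrArg _ (μ.edge_inj h)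
      · intro f
        by_cases h : ∃ e, μ.edge e = f
        · obtain ⟨e, rfl⟩ := h
          exact ⟨Sum.inr e, rfl⟩
        · exact ⟨Sum.inl ⟨f, not_exists.1 h⟩, rfl⟩
    rw [HostGraph.numEdges, ← Nat.card_congr e, Nat.card_sum, Nat.card_fin]
  have : μ.result.numEdges = Nat.card {f : G.E // ∀ e, μ.edge e ≠ f} + r.R.m := by
    rw [HostGraph.numEdges, result, Nat.card_sum, Nat.card_fin]
  omega

theorem size_result_le (hn : r.R.n ≤ r.L.n) (hm : r.R.m ≤ r.L.m) : μ.result.size ≤ G.size := by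
  have h₁ := μ.numNodes_result
  have h₂ := μ.numEdges_result
  rw [HostGraph.size, HostGraph.size]
  omega

theorem le_numNodes (μ : r.Match G) : r.L.n ≤ G.numNodes := by
  simpa [HostGraph.numNodes] using Nat.card_le_card_of_injective _ μ.node_inj

/-- The number selected by choice inside `comatch` is `i` because `numR` is injective. -/
theorem comatch_numR (i : Fin r.k) :
    μ.comatch (r.numR i) = Sum.inl ⟨μ.node (r.numL i), μ.kept_num i⟩ := by
  have h : ∃ j, r.numR j = r.numR i := ⟨i, rfl⟩
  rw [comatch, dif_pos h]
  congr 4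
  exact r.numR_inj h.choose_spec

theorem newNode_comatch (u : Fin r.R.n) : μ.newNode (μ.comatch u) = some u := by
  by_cases h : ∃ i, r.numR i = u
  · obtain ⟨i, rfl⟩ := h
    rw [comatch_numR, newNode]
    have h : ∃ j, μ.node (r.numL j) = μ.node (r.numL i) := ⟨i, rfl⟩
    rw [dif_pos h]
    congr 2
    exact r.numL_inj (μ.node_inj h.choose_spec)
  · rw [comatch, dif_neg h, newNode]

theorem comatch_eq_of_newNode {x : μ.ResV} {u : Fin r.R.n} (h : μ.newNode x = some u) :
    μ.comatch u = x := by
  match x with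
  | Sum.inl w =>
    rw [newNode] at h
    split at h
    next hw =>
      rw [← Option.some.inj h, comatch_numR]
      congr 2
      exact hw.choose_spec
    next => simp at h
  | Sum.inr u' =>
    rw [newNode] at h
    obtain rfl := Option.some.inj h
    rw [comatch, dif_neg]
    rintro ⟨i, hi⟩
    exact u'.2 i hi

theorem value_comatch {α : Type} (new : Fin r.R.n → α) (old : G.V → α) (u : Fin r.R.n) :
    μ.value new old (μ.comatch u) = new u := by
  have h := μ.newNode_comatch u
  match hx : μ.comatch u with
  | Sum.inl w =>
    rw [hx] at h
    simp only [value, h]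
  | Sum.inr u' =>
    rw [hx, newNode] at h
    obtain rfl := Option.some.inj h
    rfl

/-- A node of the result stands for a node of the right-hand graph or is an old node outside the
image of the match, which keeps its values. -/
theorem exists_comatch_or_old (x : μ.ResV) :
    (∃ u, μ.comatch u = x) ∨ ∃ w : {w : G.V // μ.Kept w}, x = Sum.inl w ∧ (∀ v, μ.node v ≠ w) ∧
      ∀ {α : Type} (new : Fin r.R.n → α) (old : G.V → α), μ.value new old x = old w := by
  cases hx : μ.newNode x with
  | some u => exact Or.inl ⟨u, μ.comatch_eq_of_newNode hx⟩
  | none =>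
    match x with
    | Sum.inr u => simp [newNode] at hx
    | Sum.inl w =>
      refine Or.inr ⟨w, rfl, fun v hv => ?_, fun new old => by simp only [value, hx]⟩
      have := w.2 v hv
      simp only [Deleted, ne_eq, not_forall, not_not] at this
      obtain ⟨i, rfl⟩ := this
      rw [newNode, dif_pos ⟨i, hv⟩] at hx
      simp at hx

theorem rooted_result_comatch (u : Fin r.R.n) :
    μ.result.rooted (μ.comatch u) = r.R.rooted u := μ.value_comatch _ _ u

end Match

end Rule

-- Cyclic graphs and regular graphs

namespace HostGraph

/-- Each node has exactly one outgoing and one incoming edge, and only the set of all nodes is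
nonempty and closed under successors. -/
structure IsCyclic (G : HostGraph) : Prop where
  src_bij : Function.Bijective G.src
  tgt_bij : Function.Bijective G.tgt
  connected : ∀ S : Set G.V, S.Nonempty → (∀ e, G.src e ∈ S → G.tgt e ∈ S) → ∀ v, v ∈ S

/-- Replaces the explicit numbering by intrinsic properties, which can be followed through rule
applications without renumbering. -/
theorem IsCycleGraph.isCyclic {G : HostGraph} (h : G.IsCycleGraph) : G.IsCyclic := by
  obtain ⟨n, v, e, hve⟩ := h
  have hs : G.src = v ∘ e.symm := by
    funext f
    obtain ⟨i, rfl⟩ := e.surjective f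
    simp [(hve i).1]
  have ht : G.tgt = v ∘ (fun i => i + 1) ∘ e.symm := by
    funext f
    obtain ⟨i, rfl⟩ := e.surjective f
    simp [(hve i).2]
  refine ⟨hs ▸ v.bijective.comp e.symm.bijective,
    ht ▸ v.bijective.comp ((Equiv.addRight (1 : Fin (n + 1))).bijective.comp e.symm.bijective), ?_⟩
  rintro S ⟨w, hw⟩ hS u
  obtain ⟨i, rfl⟩ := v.surjective w
  obtain ⟨j, rfl⟩ := v.surjective u
  -- Walking `k` steps around the cycle from `i` stays in `S`; the walk of length `j - i` ends at
  -- `j`.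
  have key : ∀ k : ℕ, v (i + (Fin.ofNat (n + 1) k)) ∈ S := by
    intro k
    induction k with
    | zero => simpa using hw
    | succ k ih =>
      have := hS (e (i + Fin.ofNat (n + 1) k)) (by rwa [(hve _).1])
      rw [(hve _).2] at this
      convert this using 2
      rw [add_assoc]
      congr 1
      ext
      simp [Fin.val_add]
  have := key (j - i).val
  simpa using this

/-- All nodes are grey, all edges are unmarked, and there is at most one root. -/
structure IsRegular (G : HostGraph) : Prop where
  grey : ∀ v, G.nodeMark v = NodeMark.grey
  unmarked : ∀ e, G.edgeMark e = EdgeMark.none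
  root_unique : ∀ v w, G.rooted v = true → G.rooted w = true → v = w

theorem IsInputGraph.isRegular {G : HostGraph} (h : G.IsInputGraph) : G.IsRegular :=
  ⟨h.1, h.2.2, fun v _ hv => by simp [h.2.1 v] at hv⟩

end HostGraph

namespace Rule.Match

variable {X : Type} {r : Rule X} {G : HostGraph}

/-- By `hL` no root lies outside the match, so every root of the result stems from `R`, which has at
most one. -/
theorem isRegular_result (μ : r.Match G) (hG : G.IsRegular)
    (hgrey : ∀ u, r.R.nodeMark u = NodeMark.grey) (hunm : ∀ e, r.R.edgeMark e = EdgeMark.none)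
    (hroot : ∀ u u', r.R.rooted u = true → r.R.rooted u' = true → u = u')
    (hL : ∀ w, G.rooted w = true → ∃ v, μ.node v = w) : μ.result.IsRegular := by
  have key : ∀ x, μ.result.rooted x = true → ∃ u, μ.comatch u = x ∧ r.R.rooted u = true := by
    intro x hx
    rcases μ.exists_comatch_or_old x with ⟨u, rfl⟩ | ⟨w, -, hw, hval⟩
    · exact ⟨u, rfl, by rwa [rooted_result_comatch] at hx⟩
    · obtain ⟨v, hv⟩ := hL w ((hval r.R.rooted G.rooted).symm.trans hx)
      exact absurd hv (hw v)
  refine ⟨fun x => ?_, ?_, fun x y hx hy => ?_⟩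
  · rcases μ.exists_comatch_or_old x with ⟨u, rfl⟩ | ⟨w, -, -, hval⟩
    · exact (μ.value_comatch _ _ u).trans (hgrey u)
    · exact (hval r.R.nodeMark G.nodeMark).trans (hG.grey w)
  · rintro (f | e)
    exacts [hG.unmarked f, hunm e]
  · obtain ⟨u, rfl, hu⟩ := key x hx
    obtain ⟨u', rfl, hu'⟩ := key y hy
    rw [hroot u u' hu hu']

theorem exists_node_of_rooted (μ : r.Match G) (hG : G.IsRegular) {v : Fin r.L.n}
    (hv : r.L.rooted v = true) (w : G.V) (hw : G.rooted w = true) : ∃ v, μ.node v = w :=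
  ⟨v, hG.root_unique _ _ ((μ.rooted_eq v).trans hv) hw⟩

end Rule.Match

namespace IsCycle

open HostGraph

/-! ### The rules -/

theorem isFast_red1 : red1.IsFast :=
  ⟨fun v => ⟨v, by revert v; decide, .refl⟩, red1.linear, by unfold Function.Injective; decide⟩

theorem isFast_red2 : red2.IsFast := by
  have h : ∀ v : Fin 2, Relation.ReflTransGen red2.L.Adj (0 : Fin 2) v := by
    intro v
    match v with
    | 0 => exact .refl
    | 1 => exact .single ⟨(0 : Fin 2), Or.inl ⟨rfl, rfl⟩⟩
  exact ⟨fun v => ⟨(0 : Fin 2), rfl, h v⟩, red2.linear, by unfold Function.Injective; decide⟩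

theorem isFast_red3 : red3.IsFast := by
  have h : ∀ v : Fin 3, Relation.ReflTransGen red3.L.Adj (1 : Fin 3) v := by
    intro v
    match v with
    | 0 => exact .single ⟨(0 : Fin 2), Or.inr ⟨rfl, rfl⟩⟩
    | 1 => exact .refl
    | 2 => exact .single ⟨(1 : Fin 2), Or.inl ⟨rfl, rfl⟩⟩
  exact ⟨fun v => ⟨(1 : Fin 3), rfl, h v⟩, red3.linear, by unfold Function.Injective; decide⟩

theorem plan_single : (single false).plan = [SearchOp.findNode (0 : Fin 1)] := rfl

theorem plan_rootedLoop :
    rootedLoop.plan = [SearchOp.findRoot (0 : Fin 1), SearchOp.outEdge (0 : Fin 1)] := rfl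

theorem plan_rootedTwoCycle : rootedTwoCycle.plan =
    [SearchOp.findRoot (0 : Fin 2), SearchOp.outEdge (0 : Fin 2), SearchOp.outEdge (1 : Fin 2)] :=
  rfl

/-- Both edges are sought from the middle node, the one that `red3` deletes. The outer nodes, whose
host degrees are unbounded, are never searched from. -/
theorem plan_path3 : path3.plan =
    [SearchOp.findRoot (1 : Fin 3), SearchOp.outEdge (1 : Fin 2), SearchOp.inEdge (0 : Fin 2)] :=
  rfl

theorem planCovers_of_L_eq_single {r : Rule Var} (hr : r.L = single false) :
    r.PlanCovers := by
  rw [Rule.PlanCovers, hr, plan_single]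
  exact ⟨fun v => ⟨_, List.mem_singleton_self _, Subsingleton.elim (α := Fin 1) _ _⟩,
    fun e => Fin.elim0 e⟩

theorem planCovers_decl (n : Name) : (decl n).PlanCovers := by
  cases n with
  | init => exact planCovers_of_L_eq_single (r := init) rfl
  | matchNode => exact planCovers_of_L_eq_single (r := matchNode) rfl
  | red1 =>
    rw [Rule.PlanCovers, show (decl Name.red1).L.plan = _ from plan_rootedLoop]
    exact ⟨fun v => ⟨_, .head _, Subsingleton.elim (α := Fin 1) _ _⟩,
      fun e => ⟨_, .tail _ (.head _), congrArg some (Subsingleton.elim (α := Fin 1) _ _)⟩⟩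
  | red2 =>
    rw [Rule.PlanCovers, show (decl Name.red2).L.plan = _ from plan_rootedTwoCycle]
    have h : ∀ v : Fin 2, v = 0 ∨ v = 1 := by decide
    refine ⟨fun v => ?_, fun e => ?_⟩
    · rcases h v with rfl | rfl
      exacts [⟨_, .head _, rfl⟩, ⟨_, .tail _ (.head _), rfl⟩]
    · rcases h e with rfl | rfl
      exacts [⟨_, .tail _ (.head _), rfl⟩, ⟨_, .tail _ (.tail _ (.head _)), rfl⟩]
  | red3 =>
    rw [Rule.PlanCovers, show (decl Name.red3).L.plan = _ from plan_path3]
    have h : ∀ v : Fin 2, v = 0 ∨ v = 1 := by decide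
    have h' : ∀ v : Fin 3, v = 0 ∨ v = 1 ∨ v = 2 := by decide
    refine ⟨fun v => ?_, fun e => ?_⟩
    · rcases h' v with rfl | rfl | rfl
      exacts [⟨_, .tail _ (.tail _ (.head _)), rfl⟩, ⟨_, .head _, rfl⟩, ⟨_, .tail _ (.head _), rfl⟩]
    · rcases h e with rfl | rfl
      exacts [⟨_, .tail _ (.tail _ (.head _)), rfl⟩, ⟨_, .tail _ (.head _), rfl⟩]

/-- Matching a single unrooted node is fast because at most one node is a root. -/
theorem findMatch_time_le_five {r : Rule Var} (hr : r.L = single false) (hk : ∀ v, ¬ r.Deleted v)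
    {G : HostGraph} (hG : G.IsRegular) (ℓ : Listing G) : (r.findMatch ℓ).1 ≤ 5 := by
  obtain ⟨v, hv⟩ : ∃ v, r.L.plan = [SearchOp.findNode v] := by
    rw [hr]
    exact ⟨_, plan_single⟩
  obtain ⟨hm, hroot, hin, hout⟩ : r.L.nodeMark v = NodeMark.grey ∧ r.L.rooted v = false ∧
      r.L.indeg v = 0 ∧ r.L.outdeg v = 0 := by
    clear hv
    revert v
    rw [hr]
    exact fun v => ⟨rfl, by revert v; decide, rfl, rfl⟩
  rw [Rule.findMatch, hv, Rule.search]
  refine tryCandidates_time_le_five (fun p => by rw [Rule.search]) ℓ.nodes_nodup ?_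
  -- Nothing is matched yet, all nodes are grey, the required degrees are 0 and no node is deleted,
  -- so only the root status can cause a rejection.
  have key : ∀ w, r.testNode v (⟨fun _ => none, fun _ => none⟩ : PartialMatch r.L G) w = none →
      G.rooted w = true := by
    intro w hw
    by_contra hwr
    rw [Rule.testNode, if_pos] at hw
    · simp at hw
    · rw [hm, hroot, hin, hout]
      exact ⟨by simp, hG.grey w, by simpa using hwr, Nat.zero_le _, Nat.zero_le _,
        fun h => absurd h (hk _)⟩
  exact fun v w hv hw => hG.root_unique v w (key v hv) (key w hw)

/-- A bound for the time of an attempt to apply a rule. -/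
def attemptBound (n : Name) : ℕ :=
  (decl n).localBound (decl n).L.plan.length + 5 + (decl n).buildTime

theorem findMatch_time_le_attemptBound (n : Name) {G : HostGraph} (hG : G.IsRegular)
    (ℓ : Listing G) : ((decl n).findMatch ℓ).1 + (decl n).buildTime ≤ attemptBound n := by
  refine Nat.add_le_add_right ?_ _
  -- The summand 5 is reserved for `init` and `matchNode`, whose plans are not local; the other
  -- rules use `localBound`.
  have hloc : (∀ op ∈ (decl n).L.plan, (decl n).Local op) →
      ((decl n).findMatch ℓ).1 ≤ (decl n).localBound (decl n).L.plan.length + 5 := fun h =>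
    (Rule.findMatch_time_le h hG.root_unique ℓ).trans (Nat.le_add_right _ _)
  cases n with
  | init =>
    exact (findMatch_time_le_five (r := init) rfl
      (fun v h => h (0 : Fin 1) (Subsingleton.elim (α := Fin 1) _ _)) hG ℓ).trans
      (Nat.le_add_left _ _)
  | matchNode =>
    exact (findMatch_time_le_five (r := matchNode) rfl
      (fun v h => h (0 : Fin 1) (Subsingleton.elim (α := Fin 1) _ _)) hG ℓ).trans
      (Nat.le_add_left _ _)
  | red1 =>
    refine hloc ?_
    rw [show (decl Name.red1).L.plan = _ from plan_rootedLoop]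
    intro op hop
    rcases hop with _ | ⟨_, _ | ⟨_, _ | _⟩⟩
    exacts [trivial, fun i => Fin.elim0 i]
  | red2 =>
    refine hloc ?_
    rw [show (decl Name.red2).L.plan = _ from plan_rootedTwoCycle]
    intro op hop
    rcases hop with _ | ⟨_, _ | ⟨_, _ | ⟨_, _ | _⟩⟩⟩
    exacts [trivial, fun i => Fin.elim0 i, fun i => Fin.elim0 i]
  | red3 =>
    refine hloc ?_
    -- The middle node is unnumbered, hence deleted, which makes both edge operations local.
    have h : ∀ i : Fin 2, (![0, 2] : Fin 2 → Fin 3) i ≠ 1 := by decide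
    rw [show (decl Name.red3).L.plan = _ from plan_path3]
    intro op hop
    rcases hop with _ | ⟨_, _ | ⟨_, _ | ⟨_, _ | _⟩⟩⟩
    exacts [trivial, h, h]

/-- A bound for the time of an attempt to apply any of the rules. -/
def maxAttempt : ℕ :=
  attemptBound Name.init + attemptBound Name.red1 + attemptBound Name.red2 +
    attemptBound Name.red3 + attemptBound Name.matchNode

theorem attemptBound_le (n : Name) : attemptBound n ≤ maxAttempt := by
  cases n <;> rw [maxAttempt] <;> omega

theorem time_le_of_succeeds {n : Name} {G H : HostGraph} {t : ℕ} (hG : G.IsRegular)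
    (h : (decl n).Succeeds G t H) : t ≤ maxAttempt ∧ ∃ μ : (decl n).Match G, H = μ.result := by
  obtain ⟨ℓ, p, s, μ, hs, -, -, rfl, rfl⟩ := h
  have := findMatch_time_le_attemptBound n hG ℓ
  have := attemptBound_le n
  rw [hs] at *
  exact ⟨by simp only at *; omega, μ, rfl⟩

theorem time_le_of_misses {n : Name} {G : HostGraph} {t : ℕ} (hG : G.IsRegular)
    (h : (decl n).Misses G t) : t ≤ maxAttempt := by
  obtain ⟨ℓ, hs⟩ := h
  have := findMatch_time_le_attemptBound n hG ℓ
  have := attemptBound_le n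
  rw [hs] at *
  simp only at *
  omega

/-! ### Regularity and cyclicity under rule application -/

theorem isRegular_result_init {G : HostGraph} (hG : G.IsInputGraph) (μ : init.Match G) :
    μ.result.IsRegular :=
  μ.isRegular_result hG.isRegular (fun _ => rfl) (fun e => Fin.elim0 e)
    (fun _ _ _ _ => Subsingleton.elim (α := Fin 1) _ _) fun w hw => by simp [hG.2.1 w] at hw

theorem isRegular_result_red1 {G : HostGraph} (hG : G.IsRegular) (μ : red1.Match G) :
    μ.result.IsRegular :=
  μ.isRegular_result hG (fun u => Fin.elim0 u) (fun e => Fin.elim0 e) (fun u => Fin.elim0 u)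
    (μ.exists_node_of_rooted hG (v := (0 : Fin 1)) rfl)

theorem isRegular_result_red2 {G : HostGraph} (hG : G.IsRegular) (μ : red2.Match G) :
    μ.result.IsRegular :=
  μ.isRegular_result hG (fun _ => rfl) (fun _ => rfl)
    (fun _ _ _ _ => Subsingleton.elim (α := Fin 1) _ _)
    (μ.exists_node_of_rooted hG (v := (0 : Fin 2)) rfl)

theorem isRegular_result_red3 {G : HostGraph} (hG : G.IsRegular) (μ : red3.Match G) :
    μ.result.IsRegular :=
  μ.isRegular_result hG (fun _ => rfl) (fun _ => rfl) (by decide)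
    (μ.exists_node_of_rooted hG (v := (1 : Fin 3)) rfl)

theorem nonempty_match_init {G : HostGraph} (hG : G.IsInputGraph) (w : G.V) :
    Nonempty (init.Match G) :=
  ⟨{ assign := fun _ => G.nodeLabel w
     node := fun _ => w
     edge := fun e => Fin.elim0 e
     node_inj := fun _ _ _ => Subsingleton.elim (α := Fin 1) _ _
     edge_inj := fun e => Fin.elim0 e
     src_eq := fun e => Fin.elim0 e
     tgt_eq := fun e => Fin.elim0 e
     nodeLabel_eq := fun _ => rfl
     edgeLabel_eq := fun e => Fin.elim0 e
     nodeMark_eq := fun _ => hG.1 w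
     edgeMark_eq := fun e => Fin.elim0 e
     rooted_eq := fun v => (hG.2.1 w).trans (by revert v; decide)
     dangling := fun _ h => absurd (Subsingleton.elim (α := Fin 1) _ _) (h (0 : Fin 1)) }⟩

/-- No node or edge is created or deleted, so the result is `G` up to the tag `Sum.inl` and the
proofs of survival. -/
theorem isCyclic_result_init {G : HostGraph} (hG : G.IsCyclic) (μ : init.Match G) :
    μ.result.IsCyclic := by
  have hV : ∀ x : μ.ResV, ∃ w, x = Sum.inl w := by
    rintro (w | ⟨u, hu⟩)
    · exact ⟨w, rfl⟩
    · exact absurd (Subsingleton.elim (α := Fin 1) _ _) (hu (0 : Fin 1))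
  have hE : ∀ x : μ.ResE, ∃ f, x = Sum.inl f := by
    rintro (f | e)
    · exact ⟨f, rfl⟩
    · exact Fin.elim0 e
  have hunm : ∀ (f : G.E) e, μ.edge e ≠ f := fun _ e => Fin.elim0 e
  refine ⟨⟨fun x y h => ?_, fun x => ?_⟩, ⟨fun x y h => ?_, fun x => ?_⟩, fun S hS hcl x => ?_⟩
  · obtain ⟨f, rfl⟩ := hE x
    obtain ⟨g, rfl⟩ := hE y
    exact congrArg _ (Subtype.ext (hG.src_bij.1 (congrArg Subtype.val (Sum.inl.inj h))))
  · obtain ⟨w, rfl⟩ := hV x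
    obtain ⟨f, hf⟩ := hG.src_bij.2 w
    exact ⟨Sum.inl ⟨f, hunm f⟩, congrArg Sum.inl (Subtype.ext hf)⟩
  · obtain ⟨f, rfl⟩ := hE x
    obtain ⟨g, rfl⟩ := hE y
    exact congrArg _ (Subtype.ext (hG.tgt_bij.1 (congrArg Subtype.val (Sum.inl.inj h))))
  · obtain ⟨w, rfl⟩ := hV x
    obtain ⟨f, hf⟩ := hG.tgt_bij.2 w
    exact ⟨Sum.inl ⟨f, hunm f⟩, congrArg Sum.inl (Subtype.ext hf)⟩
  · obtain ⟨w, rfl⟩ := hV x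
    obtain ⟨_, h⟩ := hG.connected {w | ∃ h, (Sum.inl ⟨w, h⟩ : μ.ResV) ∈ S}
      (by
        obtain ⟨y, hy⟩ := hS
        obtain ⟨w, rfl⟩ := hV y
        exact ⟨w.1, w.2, hy⟩)
      (fun e ⟨_, he⟩ => ⟨_, hcl (Sum.inl ⟨e, hunm e⟩) he⟩) w.1
    exact h

/-- The new edge inherits its source from the first matched edge and its target from the second. The
deleted middle node was the target of the first and the source of the second, so both bijections
survive. -/
theorem isCyclic_result_red3 {G : HostGraph} (hG : G.IsCyclic) (μ : red3.Match G) :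
    μ.result.IsCyclic := by
  have hV : ∀ x : μ.ResV, ∃ w, x = Sum.inl w := by
    have : ∀ u : Fin 2, ∃ i, (![0, 1] : Fin 2 → Fin 2) i = u := by decide
    rintro (w | ⟨u, hu⟩)
    · exact ⟨w, rfl⟩
    · obtain ⟨i, hi⟩ := this u
      exact absurd hi (hu i)
  have h2 : ∀ e : Fin 2, e = 0 ∨ e = 1 := by decide
  have hdel : red3.Deleted (1 : Fin 3) := by
    have : ∀ i : Fin 2, (![0, 2] : Fin 2 → Fin 3) i ≠ 1 := by decide
    exact this
  have hnode : ∀ u v : Fin 3, u ≠ v → μ.node u ≠ μ.node v := fun u v h h' => h (μ.node_inj h')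
  have hedge : ∀ d e : Fin 2, d ≠ e → μ.edge d ≠ μ.edge e := fun d e h h' => h (μ.edge_inj h')
  have hkept : ∀ w : {w // μ.Kept w}, w.1 ≠ μ.node (1 : Fin 3) := fun w h => w.2 _ h.symm hdel
  have hs0 : G.src (μ.edge (0 : Fin 2)) = μ.node (0 : Fin 3) := μ.src_eq (0 : Fin 2)
  have hs1 : G.src (μ.edge (1 : Fin 2)) = μ.node (1 : Fin 3) := μ.src_eq (1 : Fin 2)
  have ht0 : G.tgt (μ.edge (0 : Fin 2)) = μ.node (1 : Fin 3) := μ.tgt_eq (0 : Fin 2)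
  have ht1 : G.tgt (μ.edge (1 : Fin 2)) = μ.node (2 : Fin 3) := μ.tgt_eq (1 : Fin 2)
  have hsrc : μ.result.src (Sum.inr (0 : Fin 1)) =
      Sum.inl ⟨μ.node (0 : Fin 3), μ.kept_num (0 : Fin 2)⟩ := μ.comatch_numR (0 : Fin 2)
  have htgt : μ.result.tgt (Sum.inr (0 : Fin 1)) =
      Sum.inl ⟨μ.node (2 : Fin 3), μ.kept_num (1 : Fin 2)⟩ := μ.comatch_numR (1 : Fin 2)
  have hE : ∀ x : μ.ResE, x = Sum.inr (0 : Fin 1) ∨ ∃ f, x = Sum.inl f := by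
    rintro (f | e)
    · exact Or.inr ⟨f, rfl⟩
    · exact Or.inl (congrArg _ (Subsingleton.elim (α := Fin 1) _ _))
  have hf : ∀ f : G.E, f = μ.edge (0 : Fin 2) ∨ f = μ.edge (1 : Fin 2) ∨ ∀ e, μ.edge e ≠ f := by
    intro f
    by_cases h : ∃ e, μ.edge e = f
    · obtain ⟨e, rfl⟩ := h
      rcases h2 e with rfl | rfl
      exacts [Or.inl rfl, Or.inr (Or.inl rfl)]
    · exact Or.inr (Or.inr (not_exists.1 h))
  refine ⟨⟨fun x y h => ?_, fun x => ?_⟩, ⟨fun x y h => ?_, fun x => ?_⟩, fun S hS hcl x => ?_⟩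
  · rcases hE x with rfl | ⟨f, rfl⟩ <;> rcases hE y with rfl | ⟨g, rfl⟩
    · rfl
    · exact absurd (hG.src_bij.1 (hs0.trans (congrArg Subtype.val
        (Sum.inl.inj (hsrc.symm.trans h))))) (g.2 _)
    · exact absurd (hG.src_bij.1 (hs0.trans (congrArg Subtype.val
        (Sum.inl.inj (hsrc.symm.trans h.symm))))) (f.2 _)
    · exact congrArg _ (Subtype.ext (hG.src_bij.1 (congrArg Subtype.val (Sum.inl.inj h))))
  · obtain ⟨w, rfl⟩ := hV x
    obtain ⟨f, hfw⟩ := hG.src_bij.2 w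
    rcases hf f with rfl | rfl | hf
    · exact ⟨Sum.inr (0 : Fin 1), hsrc.trans (congrArg Sum.inl (Subtype.ext (hs0.symm.trans hfw)))⟩
    · exact absurd (hfw.symm.trans hs1) (hkept w)
    · exact ⟨Sum.inl ⟨f, hf⟩, congrArg Sum.inl (Subtype.ext hfw)⟩
  · rcases hE x with rfl | ⟨f, rfl⟩ <;> rcases hE y with rfl | ⟨g, rfl⟩
    · rfl
    · exact absurd (hG.tgt_bij.1 (ht1.trans (congrArg Subtype.val
        (Sum.inl.inj (htgt.symm.trans h))))) (g.2 _)
    · exact absurd (hG.tgt_bij.1 (ht1.trans (congrArg Subtype.val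
        (Sum.inl.inj (htgt.symm.trans h.symm))))) (f.2 _)
    · exact congrArg _ (Subtype.ext (hG.tgt_bij.1 (congrArg Subtype.val (Sum.inl.inj h))))
  · obtain ⟨w, rfl⟩ := hV x
    obtain ⟨f, hfw⟩ := hG.tgt_bij.2 w
    rcases hf f with rfl | rfl | hf
    · exact absurd (hfw.symm.trans ht0) (hkept w)
    · exact ⟨Sum.inr (0 : Fin 1), htgt.trans (congrArg Sum.inl (Subtype.ext (ht1.symm.trans hfw)))⟩
    · exact ⟨Sum.inl ⟨f, hf⟩, congrArg Sum.inl (Subtype.ext hfw)⟩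
  · obtain ⟨w, rfl⟩ := hV x
    -- `S` is pulled back to `G`, with the deleted middle node added exactly when its predecessor
    -- lies in `S`; this keeps the set closed along the old path.
    have := hG.connected {w | (∃ h, (Sum.inl ⟨w, h⟩ : μ.ResV) ∈ S) ∨ (w = μ.node (1 : Fin 3) ∧
        (Sum.inl ⟨μ.node (0 : Fin 3), μ.kept_num (0 : Fin 2)⟩ : μ.ResV) ∈ S)}
      (by
        obtain ⟨y, hy⟩ := hS
        obtain ⟨w, rfl⟩ := hV y
        exact ⟨w.1, Or.inl ⟨w.2, hy⟩⟩)
      (by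
        intro e he
        rcases hf e with rfl | rfl | hf
        · rw [hs0] at he
          rw [ht0]
          rcases he with ⟨_, he⟩ | ⟨he, -⟩
          · exact Or.inr ⟨rfl, he⟩
          · exact absurd he (hnode _ _ (by decide))
        · rw [hs1] at he
          rw [ht1]
          rcases he with ⟨h, -⟩ | ⟨-, he⟩
          · exact absurd rfl (hkept ⟨_, h⟩)
          · have := hcl (Sum.inr (0 : Fin 1)) (by rwa [hsrc])
            rw [htgt] at this
            exact Or.inl ⟨_, this⟩
        · rcases he with ⟨_, he⟩ | ⟨he, -⟩
          · exact Or.inl ⟨_, hcl (Sum.inl ⟨e, hf⟩) he⟩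
          · obtain ⟨d, hd⟩ := μ.dangling _ hdel e (Or.inl he)
            exact absurd hd (hf d)) w.1
    rcases this with ⟨_, h⟩ | ⟨h, -⟩
    · exact h
    · exact absurd h (hkept w)

/-- Both matched nodes are deleted, so by the dangling condition no unmatched edge leaves them. The
image of the match is closed under successors and thus contains all nodes. -/
theorem numNodes_of_match_red2 {G : HostGraph} (hG : G.IsCyclic) (μ : red2.Match G) :
    G.numNodes = 2 := by
  have h2 : ∀ e : Fin 2, e = 0 ∨ e = 1 := by decide
  have hdel : ∀ v, red2.Deleted v := fun _ i => Fin.elim0 i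
  have hsurj : Function.Surjective μ.node := by
    refine hG.connected (Set.range μ.node) ⟨_, ⟨(0 : Fin 2), rfl⟩⟩ ?_
    rintro e ⟨v, hv⟩
    obtain ⟨d, rfl⟩ := μ.dangling v (hdel v) e (Or.inl hv.symm)
    exact ⟨_, (μ.tgt_eq d).symm⟩
  have := Nat.card_congr (Equiv.ofBijective _ ⟨μ.node_inj, hsurj⟩)
  simpa [red2, rootedTwoCycle, HostGraph.numNodes] using this.symm

/-- The root `y` has one incoming edge `a` and one outgoing edge `b`, neither of them a loop, since
otherwise `{y}` would be closed under successors. If `a` starts where `b` ends, `red2` matches; if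
not, `red3` does. Uniqueness of the edges gives the dangling condition. -/
theorem nonempty_match_of_isCyclic {G : HostGraph} (hG : G.IsCyclic) (hreg : G.IsRegular)
    (hroot : ∃ v, G.rooted v = true) (hcard : G.numNodes ≠ 1) :
    Nonempty (red3.Match G) ∨ Nonempty (red2.Match G) := by
  obtain ⟨y, hy⟩ := hroot
  have hyS : ¬ ∀ e, G.src e = y → G.tgt e = y := by
    intro h
    have := hG.connected {y} ⟨y, rfl⟩ h
    exact hcard (Nat.card_eq_one_iff_exists.2 ⟨y, this⟩)
  obtain ⟨a, ha⟩ := hG.tgt_bij.2 y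
  obtain ⟨b, hb⟩ := hG.src_bij.2 y
  have hz : G.tgt b ≠ y := by
    refine fun h => hyS fun e he => ?_
    rw [hG.src_bij.1 (he.trans hb.symm), h]
  have hx : G.src a ≠ y := by
    -- If `a` were a loop, it would be the only outgoing edge `b`, whose target is not `y`.
    intro h
    rw [← hG.src_bij.1 (h.trans hb.symm)] at hz
    exact hz ha
  have hab : a ≠ b := fun h => hz (h ▸ ha)
  have hunr : ∀ w, w ≠ y → G.rooted w = false := by
    intro w hw
    by_contra h
    exact hw (hreg.root_unique _ _ (by simpa using h) hy)
  have hlab : ∀ l₁ l₂ l₃ l₄ l₅ : HostLabel, ∃ φ : Var → HostLabel,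
      φ Var.a = l₁ ∧ φ Var.b = l₂ ∧ φ Var.x = l₃ ∧ φ Var.y = l₄ ∧ φ Var.z = l₅ :=
    fun l₁ l₂ l₃ l₄ l₅ => ⟨fun v => Var.casesOn v l₁ l₂ l₃ l₄ l₅, rfl, rfl, rfl, rfl, rfl⟩
  have h2 : ∀ e : Fin 2, e = 0 ∨ e = 1 := by decide
  by_cases hxz : G.src a = G.tgt b
  · right
    -- In `red2` the edge `a` of the rule leaves the root, so it is matched to the host edge `b`.
    -- The variable `z` does not occur and gets the empty list.
    obtain ⟨φ, h₁, h₂, h₃, h₄, -⟩ := hlab (G.edgeLabel b) (G.edgeLabel a) (G.nodeLabel y)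
      (G.nodeLabel (G.src a)) []
    have hnode : Function.Injective ![y, G.src a] := by
      intro u v h
      rcases h2 u with rfl | rfl <;> rcases h2 v with rfl | rfl <;>
        first | rfl | exact absurd h hx | exact absurd h.symm hx
    have hedge : Function.Injective ![b, a] := by
      intro u v h
      rcases h2 u with rfl | rfl <;> rcases h2 v with rfl | rfl <;>
        first | rfl | exact absurd h hab | exact absurd h.symm hab
    exact ⟨{
      assign := φ
      node := ![y, G.src a]
      edge := ![b, a]
      node_inj := hnode
      edge_inj := hedge
      src_eq := fun e => by rcases h2 e with rfl | rfl; exacts [hb, rfl]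
      tgt_eq := fun e => by rcases h2 e with rfl | rfl; exacts [hxz.symm, ha]
      nodeLabel_eq := fun v => by rcases h2 v with rfl | rfl; exacts [h₃.symm, h₄.symm]
      edgeLabel_eq := fun e => by rcases h2 e with rfl | rfl; exacts [h₁.symm, h₂.symm]
      nodeMark_eq := fun v => hreg.grey _
      edgeMark_eq := fun e => hreg.unmarked _
      rooted_eq := fun v => by rcases h2 v with rfl | rfl; exacts [hy, hunr _ hx]
      dangling := fun v _ f hf => by
        rcases h2 v with rfl | rfl
        · rcases hf with hf | hf
          · exact ⟨(0 : Fin 2), hG.src_bij.1 (hb.trans hf.symm)⟩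
          · exact ⟨(1 : Fin 2), hG.tgt_bij.1 (ha.trans hf.symm)⟩
        · rcases hf with hf | hf
          · exact ⟨(1 : Fin 2), hG.src_bij.1 hf.symm⟩
          · exact ⟨(0 : Fin 2), hG.tgt_bij.1 (hxz.symm.trans hf.symm)⟩ }⟩
  · left
    have h3 : ∀ v : Fin 3, v = 0 ∨ v = 1 ∨ v = 2 := by decide
    obtain ⟨φ, h₁, h₂, h₃, h₄, h₅⟩ := hlab (G.edgeLabel a) (G.edgeLabel b) (G.nodeLabel (G.src a))
      (G.nodeLabel y) (G.nodeLabel (G.tgt b))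
    have hnode : Function.Injective ![G.src a, y, G.tgt b] := by
      intro u v h
      rcases h3 u with rfl | rfl | rfl <;> rcases h3 v with rfl | rfl | rfl <;>
        first | rfl | exact absurd h hx | exact absurd h.symm hx |
          exact absurd h hz | exact absurd h.symm hz | exact absurd h hxz | exact absurd h.symm hxz
    have hedge : Function.Injective ![a, b] := by
      intro u v h
      rcases h2 u with rfl | rfl <;> rcases h2 v with rfl | rfl <;>
        first | rfl | exact absurd h hab | exact absurd h.symm hab
    have hdel : ∀ v : Fin 3, (∀ i : Fin 2, (![0, 2] : Fin 2 → Fin 3) i ≠ v) → v = 1 := by decide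
    exact ⟨{
      assign := φ
      node := ![G.src a, y, G.tgt b]
      edge := ![a, b]
      node_inj := hnode
      edge_inj := hedge
      src_eq := fun e => by rcases h2 e with rfl | rfl; exacts [rfl, hb]
      tgt_eq := fun e => by rcases h2 e with rfl | rfl; exacts [ha, rfl]
      nodeLabel_eq := fun v => by
        rcases h3 v with rfl | rfl | rfl; exacts [h₃.symm, h₄.symm, h₅.symm]
      edgeLabel_eq := fun e => by rcases h2 e with rfl | rfl; exacts [h₁.symm, h₂.symm]
      nodeMark_eq := fun v => hreg.grey _
      edgeMark_eq := fun e => hreg.unmarked _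
      rooted_eq := fun v => by
        rcases h3 v with rfl | rfl | rfl; exacts [hunr _ hx, hy, hunr _ hz]
      dangling := fun v hv f hf => by
        obtain rfl := hdel v hv
        rcases hf with hf | hf
        · exact ⟨(1 : Fin 2), hG.src_bij.1 (hb.trans hf.symm)⟩
        · exact ⟨(0 : Fin 2), hG.tgt_bij.1 (ha.trans hf.symm)⟩ }⟩

end IsCycle

/-! ### Rule set calls -/

section Calls

variable {X ρ : Type} {D : ρ → Rule X} {G : HostGraph}

theorem not_step_done {H : HostGraph} {τ : List (Event ρ)} {δ : Config ρ} :
    ¬ Step D (Config.done H) τ δ := fun h => by cases h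

theorem not_step_fail {τ : List (Event ρ)} {δ : Config ρ} : ¬ Step D Config.fail τ δ :=
  fun h => by cases h

/-- The failing alternative also records that no rule has a match, as `Step.call₂` requires; this
gives progress for rule set calls. -/
theorem exists_tries (hD : ∀ r, (D r).PlanCovers) (G : HostGraph) (rs : List ρ) :
    (∃ τ H, Tries D G rs τ (some H)) ∨
      ((∃ τ, Tries D G rs τ none) ∧ ∀ r ∈ rs, IsEmpty ((D r).Match G)) := by
  induction rs with
  | nil => exact Or.inr ⟨⟨[], .nil⟩, by simp⟩
  | cons r rs ih =>
    rcases Rule.succeeds_or_misses (hD r) G with ⟨t, H, h⟩ | ⟨⟨t, h⟩, hr⟩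
    · exact Or.inl ⟨_, H, .hit h⟩
    · rcases ih with ⟨τ, H, hτ⟩ | ⟨⟨τ, hτ⟩, hrs⟩
      · exact Or.inl ⟨_, H, .miss h hτ⟩
      · exact Or.inr ⟨⟨_, .miss h hτ⟩, by simpa using ⟨hr, hrs⟩⟩

theorem exists_step_call (hD : ∀ r, (D r).PlanCovers) (G : HostGraph) (R : List ρ) :
    ∃ τ, (∃ H, Step D (Config.run (Com.call R) G) τ (Config.done H)) ∨
      Step D (Config.run (Com.call R) G) τ Config.fail := by
  rcases exists_tries hD G R with ⟨τ, H, h⟩ | ⟨⟨τ, h⟩, hR⟩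
  · exact ⟨_, Or.inl ⟨H, .call₁ (.refl R) h⟩⟩
  · exact ⟨_, Or.inr (.call₂ (.refl R) h hR)⟩

theorem Step.steps {γ δ : Config ρ} {τ : List (Event ρ)} (h : Step D γ τ δ) : Steps D γ τ δ := by
  simpa using Steps.head h .refl

/-- An execution of a rule set call consists of at most one transition. -/
theorem step_of_steps_call {R : List ρ} {τ : List (Event ρ)} {δ : Config ρ}
    (h : Steps D (Config.run (Com.call R) G) τ δ) :
    δ = Config.run (Com.call R) G ∨ Step D (Config.run (Com.call R) G) τ δ := by
  cases h with
  | refl => exact Or.inl rfl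
  | head hs ht =>
    right
    cases hs with
    | call₁ hp hT =>
      cases ht with
      | refl => simpa using Step.call₁ hp hT
      | head hs _ => exact absurd hs not_step_done
    | call₂ hp hT hR =>
      cases ht with
      | refl => simpa using Step.call₂ hp hT hR
      | head hs _ => exact absurd hs not_step_fail

/-- The events take at most the time `T` altogether, and each rule application among them at most
the time `K`. -/
def Within (K T : ℕ) (τ : List (Event ρ)) : Prop :=
  traceTime τ ≤ T ∧ ∀ r ok t, Event.rule r ok t ∈ τ → t ≤ K

theorem Within.control {K T : ℕ} {τ : List (Event ρ)} (h : Within K T τ) (s : ℕ) :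
    Within K (T + s) (Event.control s :: τ) := by
  refine ⟨?_, fun r ok t ht => h.2 r ok t (by simpa using ht)⟩
  have := h.1
  simp only [traceTime, List.map_cons, List.sum_cons, Event.time] at *
  omega

theorem Within.rule {K T : ℕ} {τ : List (Event ρ)} (h : Within K T τ) {r : ρ} {ok : Bool} {t : ℕ}
    (ht : t ≤ K) : Within K (T + K) (Event.rule r ok t :: τ) := by
  refine ⟨?_, fun r' ok' t' h' => ?_⟩
  · have := h.1
    simp only [traceTime, List.map_cons, List.sum_cons, Event.time] at *
    omega
  · rcases List.mem_cons.1 h' with h' | h'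
    · cases h'
      exact ht
    · exact h.2 _ _ _ h'

theorem Within.mono {K T T' : ℕ} {τ : List (Event ρ)} (h : Within K T τ) (hT : T ≤ T') :
    Within K T' τ := ⟨h.1.trans hT, h.2⟩

theorem Within.nil (K : ℕ) : Within K 0 ([] : List (Event ρ)) := by
  simp [Within, traceTime]

theorem traceTime_append (τ τ' : List (Event ρ)) :
    traceTime (τ ++ τ') = traceTime τ + traceTime τ' := by
  simp [traceTime]

end Calls

namespace IsCycle

open HostGraph

theorem numReductions_control (t : ℕ) (τ : List (Event Name)) :
    numReductions (Event.control t :: τ) = numReductions τ := by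
  simp [numReductions, isReduction]

theorem numReductions_append (τ τ' : List (Event Name)) :
    numReductions (τ ++ τ') = numReductions τ + numReductions τ' := by
  simp [numReductions]

theorem numReductions_miss (r : Name) (t : ℕ) (τ : List (Event Name)) :
    numReductions (Event.rule r false t :: τ) = numReductions τ := by
  cases r <;> simp [numReductions, isReduction]

/-- The outcome of trying some rules: no match at all, or the application of one of them. -/
theorem tries_outcome {G : HostGraph} (hG : G.IsRegular) {rs : List Name}
    {τ : List (Event Name)} {o : Option HostGraph} (h : Tries decl G rs τ o) :
    Within maxAttempt (rs.length * maxAttempt) τ ∧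
      ((o = none ∧ numReductions τ = 0) ∨ ∃ r ∈ rs, ∃ μ : (decl r).Match G, o = some μ.result ∧
        numReductions τ = if r = Name.red3 ∨ r = Name.red2 then 1 else 0) := by
  induction h with
  | nil => exact ⟨(Within.nil _).mono (Nat.zero_le _), Or.inl ⟨rfl, rfl⟩⟩
  | @hit r rs t H h =>
    obtain ⟨ht, μ, rfl⟩ := time_le_of_succeeds hG h
    refine ⟨((Within.nil _).rule ht).mono ?_, Or.inr ⟨r, List.mem_cons_self, μ, rfl, ?_⟩⟩
    · rw [List.length_cons, Nat.add_mul]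
      omega
    · cases r <;> simp [numReductions, isReduction]
  | @miss r rs t τ o h _ ih =>
    refine ⟨(ih.1.rule (time_le_of_misses hG h)).mono ?_, ?_⟩
    · rw [List.length_cons, Nat.add_mul]
      omega
    · rw [numReductions_miss]
      rcases ih.2 with h | ⟨r', hr', h⟩
      exacts [Or.inl h, Or.inr ⟨r', List.mem_cons_of_mem _ hr', h⟩]

theorem call_outcome {G : HostGraph} (hG : G.IsRegular) {R : List Name}
    {τ : List (Event Name)} {δ : Config Name} (h : Step decl (Config.run (Com.call R) G) τ δ) :
    Within maxAttempt (R.length * maxAttempt + 1) τ ∧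
      ((δ = Config.fail ∧ numReductions τ = 0 ∧ ∀ r ∈ R, IsEmpty ((decl r).Match G)) ∨
        ∃ r ∈ R, ∃ μ : (decl r).Match G, δ = Config.done μ.result ∧
          numReductions τ = if r = Name.red3 ∨ r = Name.red2 then 1 else 0) := by
  cases h with
  | call₁ hp hT =>
    obtain ⟨h₁, ⟨h, -⟩ | ⟨r, hr, μ, h, hn⟩⟩ := tries_outcome hG hT
    · simp at h
    · rw [numReductions_control]
      exact ⟨(hp.length_eq ▸ h₁).control 1,
        Or.inr ⟨r, hp.mem_iff.1 hr, μ, congrArg _ (Option.some.inj h), hn⟩⟩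
  | call₂ hp hT hR =>
    obtain ⟨h₁, ⟨-, h⟩ | ⟨r, hr, μ, h, hn⟩⟩ := tries_outcome hG hT
    · rw [numReductions_control]
      exact ⟨(hp.length_eq ▸ h₁).control 1, Or.inl ⟨rfl, h, hR⟩⟩
    · simp at h

/-! ### Executions of the program -/

/-- The number `k` of reductions is possible for a whole execution on `G`. -/
def Complete (G : HostGraph) (k : ℕ) : Prop :=
  k ≤ G.numNodes - 1 ∧ (G.IsCycleGraph → k = G.numNodes - 1)

/-- `Reach G k m γ` describes the configurations `γ` that are reached from `G` after `k`
reductions; at most `m` transitions follow. -/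
inductive Reach (G : HostGraph) : ℕ → ℕ → Config Name → Prop
  | start : Reach G 0 (G.numNodes + 7) (Config.run program G)
  | reducing {H : HostGraph} {k : ℕ} (hH : H.IsRegular) (hs : H.size ≤ G.size)
      (hk : H.numNodes + k = G.numNodes) (hpos : 1 ≤ H.numNodes)
      (hcyc : G.IsCycleGraph → (H.IsCyclic ∧ ∃ v, H.rooted v = true) ∨ H.numNodes = 1) :
      Reach G k (H.numNodes + 6) (Config.run (Com.seq reduce check) H)
  | reduced {H : HostGraph} {k : ℕ} (hH : H.IsRegular) (hs : H.size ≤ G.size)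
      (hk : Complete G k) :
      Reach G k 5 (Config.run (Com.seq (Com.call [Name.red1]) check) H)
  | checking {H : HostGraph} {k : ℕ} (hH : H.IsRegular) (hs : H.size ≤ G.size)
      (hk : Complete G k) : Reach G k 4 (Config.run check H)
  | branching {H : HostGraph} {k : ℕ} (hH : H.IsRegular) (hs : H.size ≤ G.size)
      (hk : Complete G k) :
      Reach G k 3 (Config.run (Com.ifte (Com.call [Name.matchNode]) Com.fail Com.skip) H)
  | failing {H : HostGraph} {k : ℕ} (hk : Complete G k) : Reach G k 2 (Config.run Com.fail H)
  | skipping {H : HostGraph} {k : ℕ} (hs : H.size ≤ G.size) (hk : Complete G k) :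
      Reach G k 2 (Config.run Com.skip H)
  | done {H : HostGraph} {k : ℕ} (hs : H.size ≤ G.size) (hk : Complete G k) :
      Reach G k 0 (Config.done H)
  | failed {k : ℕ} (hk : Complete G k) : Reach G k 0 Config.fail

/-- A bound for the time of a transition. -/
def stepBound : ℕ := 4 * maxAttempt + 6

theorem reach_init {G : HostGraph} (hG : G.IsInputGraph) (μ : init.Match G) :
    Reach G 0 (G.numNodes + 6) (Config.run (Com.seq reduce check) μ.result) := by
  have hn : μ.result.numNodes = G.numNodes := by
    have := μ.numNodes_result
    simp only [init, single] at this ⊢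
    omega
  have hpos : 1 ≤ G.numNodes := μ.le_numNodes
  rw [← hn]
  refine .reducing (isRegular_result_init hG μ) (μ.size_result_le le_rfl le_rfl) hn (hn ▸ hpos)
    fun h => Or.inl ⟨isCyclic_result_init h.isCyclic μ, _, μ.rooted_result_comatch (0 : Fin 1)⟩

/-- A cycle graph has a node, which `init` could match, so failure at once does not contradict the
exact count. -/
theorem complete_of_isEmpty_init {G : HostGraph} (hG : G.IsInputGraph) (h : IsEmpty (init.Match G)) :
    Complete G 0 := by
  refine ⟨Nat.zero_le _, ?_⟩
  rintro ⟨n, v, -⟩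
  exact absurd (nonempty_match_init hG (v 0)) (not_nonempty_iff.2 h)

theorem reach_red3 {G H : HostGraph} {k : ℕ} (hH : H.IsRegular) (hs : H.size ≤ G.size)
    (hk : H.numNodes + k = G.numNodes)
    (hcyc : G.IsCycleGraph → (H.IsCyclic ∧ ∃ v, H.rooted v = true) ∨ H.numNodes = 1)
    (μ : red3.Match H) :
    μ.result.numNodes + 1 = H.numNodes ∧ Reach G (k + 1) (μ.result.numNodes + 6)
      (Config.run (Com.seq reduce check) μ.result) := by
  have h3 : 3 ≤ H.numNodes := μ.le_numNodes
  have hn : μ.result.numNodes + 3 = H.numNodes + 2 := μ.numNodes_result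
  refine ⟨by omega, .reducing (isRegular_result_red3 hH μ)
    ((μ.size_result_le (by decide) (by decide)).trans hs) (by omega) (by omega) fun h => ?_⟩
  rcases hcyc h with ⟨h, -⟩ | h
  · exact Or.inl ⟨isCyclic_result_red3 h μ, _, μ.rooted_result_comatch (0 : Fin 2)⟩
  · omega

/-- On a cycle `red2` leaves a single node. This is why the invariant allows `numNodes = 1` as an
alternative: cyclicity of the result need not be shown. -/
theorem reach_red2 {G H : HostGraph} {k : ℕ} (hH : H.IsRegular) (hs : H.size ≤ G.size)
    (hk : H.numNodes + k = G.numNodes)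
    (hcyc : G.IsCycleGraph → (H.IsCyclic ∧ ∃ v, H.rooted v = true) ∨ H.numNodes = 1)
    (μ : red2.Match H) :
    μ.result.numNodes + 1 = H.numNodes ∧ Reach G (k + 1) (μ.result.numNodes + 6)
      (Config.run (Com.seq reduce check) μ.result) := by
  have h2 : 2 ≤ H.numNodes := μ.le_numNodes
  have hn : μ.result.numNodes + 2 = H.numNodes + 1 := μ.numNodes_result
  refine ⟨by omega, .reducing (isRegular_result_red2 hH μ)
    ((μ.size_result_le (by decide) (by decide)).trans hs) (by omega) (by omega) fun h => ?_⟩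
  rcases hcyc h with ⟨h, -⟩ | h
  · have := numNodes_of_match_red2 h μ
    omega
  · omega

/-- The transitions of the reduction loop. -/
theorem step_alap {H : HostGraph} (hH : H.IsRegular) {τ : List (Event Name)} {δ : Config Name}
    (h : Step decl (Config.run (Com.alap (Com.call [Name.red3, Name.red2])) H) τ δ) :
    Within maxAttempt (4 * maxAttempt + 4) τ ∧
      ((δ = Config.done H ∧ numReductions τ = 0 ∧ IsEmpty (red3.Match H) ∧
          IsEmpty (red2.Match H)) ∨
        ∃ H', δ = Config.run (Com.alap (Com.call [Name.red3, Name.red2])) H' ∧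
          numReductions τ = 1 ∧
          ((∃ μ : red3.Match H, H' = μ.result) ∨ ∃ μ : red2.Match H, H' = μ.result)) := by
  cases h with
  | @alap₁ _ _ H' σ h =>
    rcases step_of_steps_call h with h | h
    · simp at h
    obtain ⟨hw, ⟨h, -⟩ | ⟨r, hr, μ, h, hn⟩⟩ := call_outcome hH h
    · simp at h
    · refine ⟨(hw.control 1).mono ?_, Or.inr ⟨H', rfl, ?_, ?_⟩⟩
      · simp only [List.length_cons, List.length_nil]
        omega
      · rw [numReductions_control, hn, if_pos (by simpa using hr)]
      · cases h
        simp only [List.mem_cons, List.not_mem_nil, or_false] at hr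
        rcases hr with rfl | rfl
        exacts [Or.inl ⟨μ, rfl⟩, Or.inr ⟨μ, rfl⟩]
  | alap₂ h =>
    rcases step_of_steps_call h with h | h
    · simp at h
    obtain ⟨hw, ⟨-, hn, hR⟩ | ⟨r, hr, μ, h, hn⟩⟩ := call_outcome hH h
    · refine ⟨(hw.control _).mono ?_, Or.inl ⟨rfl, ?_, hR Name.red3 (by simp),
        hR Name.red2 (by simp)⟩⟩
      -- Undoing is charged as much as the failed attempts of the two rules, hence the factor 4.
      · have := hw.1
        simp only [List.length_cons, List.length_nil] at *
        omega
      · rw [numReductions_control, hn]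
    · simp at h
  | alap₃ h =>
    rcases step_of_steps_call h with h | h
    · simp at h
    · obtain ⟨-, ⟨h, -⟩ | ⟨r, hr, μ, h, hn⟩⟩ := call_outcome hH h <;> simp at h

/-- If neither rule matches, a cycle must have shrunk to one node, and each removed node was one
reduction. -/
theorem complete_of_isEmpty {G H : HostGraph} {k : ℕ} (hH : H.IsRegular)
    (hk : H.numNodes + k = G.numNodes) (hpos : 1 ≤ H.numNodes)
    (hcyc : G.IsCycleGraph → (H.IsCyclic ∧ ∃ v, H.rooted v = true) ∨ H.numNodes = 1)
    (h3 : IsEmpty (red3.Match H)) (h2 : IsEmpty (red2.Match H)) : Complete G k := by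
  refine ⟨by omega, fun h => ?_⟩
  suffices H.numNodes = 1 by omega
  by_contra hne
  rcases hcyc h with ⟨hc, hr⟩ | h
  · rcases nonempty_match_of_isCyclic hc hH hr hne with h | h
    exacts [not_nonempty_iff.2 h3 h, not_nonempty_iff.2 h2 h]
  · exact hne h

/-- The invariant is closed under transitions, with strictly decreasing potential and bounded cost.
In the loop the potential drops because a reduction removes a node; elsewhere the program proceeds
to a later phase. -/
theorem Reach.step {G : HostGraph} (hG : G.IsInputGraph) {k m : ℕ} {γ δ : Config Name}
    {τ : List (Event Name)} (hγ : Reach G k m γ) (h : Step decl γ τ δ) :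
    (∃ m' < m, Reach G (k + numReductions τ) m' δ) ∧ Within maxAttempt stepBound τ := by
  cases hγ with
  | start =>
    rw [program] at h
    cases h with
    | seq₁ h => obtain ⟨-, ⟨h, -⟩ | ⟨_, -, _, h, -⟩⟩ := call_outcome hG.isRegular h <;> simp at h
    | seq₂ h =>
      obtain ⟨hw, ⟨h, -⟩ | ⟨r, hr, μ, h, hn⟩⟩ := call_outcome hG.isRegular h
      · simp at h
      · obtain rfl := List.mem_singleton.1 hr
        cases h
        rw [numReductions_control, hn]
        refine ⟨⟨_, by omega, reach_init hG μ⟩, (hw.control 1).mono ?_⟩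
        simp only [List.length_cons, List.length_nil, stepBound]
        omega
    | seq₃ h =>
      obtain ⟨hw, ⟨-, hn, hR⟩ | ⟨_, -, _, h, -⟩⟩ := call_outcome hG.isRegular h
      · rw [numReductions_control, hn]
        refine ⟨⟨0, by omega, .failed (complete_of_isEmpty_init hG (hR _ (List.mem_singleton_self _)))⟩,
          (hw.control 1).mono ?_⟩
        simp only [List.length_cons, List.length_nil, stepBound]
        omega
      · simp at h
  | @reducing H k hH hs hk hpos hcyc =>
    rw [reduce] at h
    cases h with
    | seq₁ h =>
      cases h with
      | seq₁ h =>
        obtain ⟨hw, ⟨h, -⟩ | ⟨H', h, hn, hH'⟩⟩ := step_alap hH h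
        · simp at h
        cases h
        rw [numReductions_control, numReductions_control, hn]
        -- The loop lies inside two sequential compositions, each charging one unit; this is where
        -- the 6 in `stepBound` comes from.
        refine ⟨?_, ((hw.control 1).control 1).mono le_rfl⟩
        rcases hH' with ⟨μ, rfl⟩ | ⟨μ, rfl⟩
        · obtain ⟨h₁, h₂⟩ := reach_red3 hH hs hk hcyc μ
          exact ⟨_, by omega, h₂⟩
        · obtain ⟨h₁, h₂⟩ := reach_red2 hH hs hk hcyc μ
          exact ⟨_, by omega, h₂⟩
      | seq₂ h =>
        obtain ⟨hw, ⟨h, hn, h3, h2⟩ | ⟨H', h, -⟩⟩ := step_alap hH h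
        · cases h
          rw [numReductions_control, numReductions_control, hn]
          exact ⟨⟨5, by omega, .reduced hH hs (complete_of_isEmpty hH hk hpos hcyc h3 h2)⟩,
            ((hw.control 1).control 1).mono le_rfl⟩
        · simp at h
    | seq₂ h => cases h
    | seq₃ h =>
      cases h with
      | seq₃ h => obtain ⟨-, ⟨h, -⟩ | ⟨_, h, -⟩⟩ := step_alap hH h <;> simp at h
  | @reduced H k hH hs hk =>
    cases h with
    | seq₁ h => obtain ⟨-, ⟨h, -⟩ | ⟨_, -, _, h, -⟩⟩ := call_outcome hH h <;> simp at h
    | seq₂ h =>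
      obtain ⟨hw, ⟨h, -⟩ | ⟨r, hr, μ, h, hn⟩⟩ := call_outcome hH h
      · simp at h
      · obtain rfl := List.mem_singleton.1 hr
        cases h
        rw [numReductions_control, hn]
        refine ⟨⟨4, by omega, .checking (isRegular_result_red1 hH μ)
          ((μ.size_result_le (Nat.zero_le _) (Nat.zero_le _)).trans hs) hk⟩,
          (hw.control 1).mono ?_⟩
        simp only [List.length_cons, List.length_nil, stepBound]
        omega
    | seq₃ h =>
      obtain ⟨hw, ⟨-, hn, -⟩ | ⟨_, -, _, h, -⟩⟩ := call_outcome hH h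
      · rw [numReductions_control, hn]
        refine ⟨⟨0, by omega, .failed hk⟩, (hw.control 1).mono ?_⟩
        simp only [List.length_cons, List.length_nil, stepBound]
        omega
      · simp at h
  | @checking H k hH hs hk =>
    rw [check] at h
    cases h with
    | if₃ =>
      refine ⟨⟨3, by omega, .branching hH hs hk⟩, ((Within.nil _).control 1).mono ?_⟩
      rw [stepBound]
      omega
  | @branching H k hH hs hk =>
    have key : ∀ {σ : List (Event Name)} {δ : Config Name},
        Step decl (Config.run (Com.call [Name.matchNode]) H) σ δ →
        numReductions σ = 0 ∧
          Within maxAttempt stepBound (Event.control (traceTime σ + 1) :: σ) := by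
      intro σ δ h
      obtain ⟨hw, ho⟩ := call_outcome hH h
      refine ⟨?_, (hw.control _).mono ?_⟩
      · rcases ho with ⟨-, h, -⟩ | ⟨r, hr, _, -, h⟩
        · exact h
        · obtain rfl := List.mem_singleton.1 hr
          exact h
      · have := hw.1
        simp only [List.length_cons, List.length_nil, stepBound] at *
        omega
    cases h with
    | if₁ h =>
      rcases step_of_steps_call h with h | h
      · simp at h
      rw [numReductions_control, (key h).1]
      exact ⟨⟨2, by omega, .failing hk⟩, (key h).2⟩
    | if₂ h =>
      rcases step_of_steps_call h with h | h
      · simp at h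
      rw [numReductions_control, (key h).1]
      exact ⟨⟨2, by omega, .skipping hs hk⟩, (key h).2⟩
  | failing hk =>
    cases h with
    | fail =>
      refine ⟨⟨0, by omega, .failed hk⟩, ((Within.nil _).control 1).mono ?_⟩
      rw [stepBound]
      omega
  | skipping hs hk =>
    cases h with
    | skip =>
      refine ⟨⟨0, by omega, .done hs hk⟩, ((Within.nil _).control 1).mono ?_⟩
      rw [stepBound]
      omega
  | done => exact absurd h not_step_done
  | failed => exact absurd h not_step_fail

-- Progress, total time and termination

theorem Reach.exists_step {G : HostGraph} {k m : ℕ} {P : Com Name} {H : HostGraph}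
    (h : Reach G k m (Config.run P H)) : ∃ τ δ, Step decl (Config.run P H) τ δ := by
  cases h with
  | start =>
    obtain ⟨τ, ⟨H, h⟩ | h⟩ := exists_step_call planCovers_decl G [Name.init]
    exacts [⟨_, _, .seq₂ h⟩, ⟨_, _, .seq₃ h⟩]
  | reducing hH =>
    obtain ⟨τ, ⟨H', h⟩ | h⟩ := exists_step_call planCovers_decl H [Name.red3, Name.red2]
    exacts [⟨_, _, .seq₁ (.seq₁ (.alap₁ h.steps))⟩, ⟨_, _, .seq₁ (.seq₂ (.alap₂ h.steps))⟩]
  | reduced =>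
    obtain ⟨τ, ⟨H', h⟩ | h⟩ := exists_step_call planCovers_decl H [Name.red1]
    exacts [⟨_, _, .seq₂ h⟩, ⟨_, _, .seq₃ h⟩]
  | checking => exact ⟨_, _, .if₃⟩
  | branching =>
    obtain ⟨τ, ⟨H', h⟩ | h⟩ := exists_step_call planCovers_decl H [Name.matchNode]
    exacts [⟨_, _, .if₁ h.steps⟩, ⟨_, _, .if₂ h.steps⟩]
  | failing => exact ⟨_, _, .fail⟩
  | skipping => exact ⟨_, _, .skip⟩

/-- Amortised form of `Reach.step`: each unit of potential pays for one transition, so the elapsed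
time plus the remaining credit never exceeds the initial credit. -/
theorem Reach.steps {G : HostGraph} (hG : G.IsInputGraph) {γ δ : Config Name}
    {τ : List (Event Name)} (h : Steps decl γ τ δ) {k m : ℕ} (hγ : Reach G k m γ) :
    ∃ m', Reach G (k + numReductions τ) m' δ ∧
      traceTime τ + stepBound * m' ≤ stepBound * m ∧
      ∀ r ok t, Event.rule r ok t ∈ τ → t ≤ maxAttempt := by
  match h with
  | .refl => exact ⟨m, hγ, by simp [traceTime], by simp⟩
  | @Steps.head _ _ _ _ _ _ τ₁ τ₂ h hs =>
    obtain ⟨⟨m₁, hm₁, h₁⟩, hw⟩ := hγ.step hG h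
    obtain ⟨m₂, h₂, ht, hr⟩ := Reach.steps hG hs h₁
    refine ⟨m₂, ?_, ?_, fun r ok t h => ?_⟩
    · rw [numReductions_append, ← add_assoc]
      exact h₂
    · have := Nat.mul_le_mul_left stepBound (Nat.succ_le_of_lt hm₁)
      rw [Nat.mul_succ] at this
      have := hw.1
      rw [traceTime_append]
      omega
    · rcases List.mem_append.1 h with h | h
      exacts [hw.2 r ok t h, hr r ok t h]

theorem Reach.not_diverges {G : HostGraph} (hG : G.IsInputGraph) (m : ℕ) :
    ∀ (k : ℕ) (γ : ℕ → Config Name), Reach G k m (γ 0) →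
      ¬ ∀ i, ∃ τ, Step decl (γ i) τ (γ (i + 1)) := by
  induction m using Nat.strong_induction_on with
  | _ m ih =>
    intro k γ h hγ
    obtain ⟨τ, hτ⟩ := hγ 0
    obtain ⟨⟨m', hm', h'⟩, -⟩ := h.step hG hτ
    exact ih m' hm' _ (fun i => γ (i + 1)) h' fun i => hγ (i + 1)

theorem Reach.le {G : HostGraph} {k m : ℕ} {γ : Config Name} (h : Reach G k m γ) :
    k ≤ G.numNodes - 1 := by
  cases h with
  | start => exact Nat.zero_le _
  | reducing => omega
  | reduced _ _ hk => exact hk.1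
  | checking _ _ hk => exact hk.1
  | branching _ _ hk => exact hk.1
  | failing hk => exact hk.1
  | skipping _ hk => exact hk.1
  | done _ hk => exact hk.1
  | failed hk => exact hk.1

theorem Reach.complete {G : HostGraph} {k m : ℕ} {γ : Config Name} (h : Reach G k m γ)
    (hγ : γ.IsFinal) : Complete G k := by
  cases h with
  | done _ hk => exact hk
  | failed hk => exact hk
  | _ => exact hγ.elim

theorem Reach.printTime_le {G : HostGraph} {k m : ℕ} {γ : Config Name} (h : Reach G k m γ) :
    γ.printTime ≤ G.size + 1 := by
  cases h with
  | done hs => exact Nat.succ_le_succ hs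
  | _ => exact Nat.zero_le _

end IsCycle

-- The complexity theorem

theorem mainTheorem8 :
    (IsCycle.red1.IsFast ∧ IsCycle.red2.IsFast ∧ IsCycle.red3.IsFast) ∧
    ∃ c K : ℕ, ∀ G : HostGraph, G.IsInputGraph →
      ¬ CanDiverge IsCycle.decl IsCycle.program G ∧
      ¬ CanGetStuck IsCycle.decl IsCycle.program G ∧
      ∀ (τ : List (Event IsCycle.Name)) (γ : Config IsCycle.Name),
        Steps IsCycle.decl (Config.run IsCycle.program G) τ γ →
          runningTime G τ γ ≤ c * (G.size + 1) ∧
          (∀ (r : IsCycle.Name) (ok : Bool) (t : ℕ), Event.rule r ok t ∈ τ → t ≤ K) ∧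
          IsCycle.numReductions τ ≤ G.numNodes - 1 ∧
          (G.IsCycleGraph → γ.IsFinal → IsCycle.numReductions τ = G.numNodes - 1) := by
  refine ⟨⟨IsCycle.isFast_red1, IsCycle.isFast_red2, IsCycle.isFast_red3⟩,
    7 * IsCycle.stepBound + 2, IsCycle.maxAttempt, fun G hG => ⟨?_, ?_, fun τ γ h => ?_⟩⟩
  · rintro ⟨γ, h0, hγ⟩
    exact IsCycle.Reach.not_diverges hG _ 0 γ (by rw [h0]; exact .start) hγ
  · rintro ⟨Q, H, τ, h, hstuck⟩
    obtain ⟨m, hm, -⟩ := IsCycle.Reach.steps hG h .start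
    obtain ⟨τ', δ, hδ⟩ := hm.exists_step
    exact hstuck τ' δ hδ
  · obtain ⟨m, hm, ht, hr⟩ := IsCycle.Reach.steps hG h .start
    rw [Nat.zero_add] at hm
    refine ⟨?_, hr, hm.le, fun hc hf => (hm.complete hf).2 hc⟩
    have hp := hm.printTime_le
    -- The initial potential is absorbed into a multiple of `size + 1`. Reading the input and
    -- writing the output contribute the further 2 in the constant.
    have hsize : G.numNodes + 7 ≤ 7 * (G.size + 1) := by
      rw [HostGraph.size]
      omega
    calc runningTime G τ γ = (G.size + 1) + traceTime τ + γ.printTime := rfl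
      _ ≤ (G.size + 1) + IsCycle.stepBound * (7 * (G.size + 1)) + (G.size + 1) := by
        have := Nat.mul_le_mul_left IsCycle.stepBound hsize
        omega
      _ = (7 * IsCycle.stepBound + 2) * (G.size + 1) := by ring
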